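/- Let $p\ge 1$ and let $\mathbb S(p)$ be the space of real symmetric $p\times p$ matrices with the inner product $X\bullet U=\mathrm{trace}(XU)$; for a finite index set $Q$ write $\mathbb S(Q)$ for the real symmetric matrices indexed by $Q$. Let $$\mathcal{COP}(p)=\{D\in\mathbb S(p): t^\top Dt\ge 0\ \ \forall t\in\mathbb R^p_+\},\qquad \mathcal{CP}(p)=\mathrm{cone}\{tt^\top: t\in\mathbb R^p_+\}$$ be the cone of copositive matrices and its dual, the cone of completely positive matrices, and let $$\mathbb C=\{(X,U)\in\mathcal{COP}(p)\times\mathcal{CP}(p): X\bullet U=0\}$$ be the complementarity set. Fix $(X^0,U^0)\in\mathbb C$. Let $P=\{1,\dots,p\}$, $\mathrm{supp}(t)=\{k\in P:t_k\ne0\}$ and $T_a=\{t\in\mathbb R^p_+:\sum_k|t_k|=1,\ t^\top X^0t=0\}$. Let $\tau(j)$, $j\in J=\{1,\dots,n\}$, be the (finitely many, pairwise distinct) vertices of $\mathrm{conv}\,T_a$, and let $M(j)=\{k\in P:e_k^\top X^0\tau(j)=0\}$. Let $J(s)\subset J$, $s\in S=\{1,\dots,m\}$, be a family with the following properties, the number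 $m$ of its members being the largest possible among all families with these properties: a) $J=\bigcup_{s\in S}J(s)$; b) for every $s\in S$, $\ P_*(s):=\bigcup_{j\in J(s)}\mathrm{supp}(\tau(j))\subset M(i)$ for all $i\in J(s)$; c) for all $s\neq\bar s$ in $S$: $J(s)\setminus J(\bar s)\ne\emptyset$, $J(\bar s)\setminus J(s)\neq\emptyset$, and for every $i_0\in J(s)\setminus J(\bar s)$ there are $j_0\in J(\bar s)\setminus J(s)$ and $k_0\in\mathrm{supp}(\tau(i_0))$ with $k_0\notin M(j_0)$. For each $s\in S$ let $J_b(s)\subset J(s)$ satisfy $\mathrm{rank}(\tau(j),\,j\in J(s))=\mathrm{rank}(\tau(j),\,j\in J_b(s))=|J_b(s)|$. Assume: j) $U^0$ is strictly complementary to $X^0$, that is, $U^0$ lies in the relative interior of $\{U\in\mathcal{CP}(p): X^0\bullet U=0\}$; jj) the matrices $(\tau(i)+\tau(j))(\tau(i)+\tau(j))^\top$, $i,j\in J_b(s)$, $i\le j$, $s\in S$, are linearly independent; jjj) $M(j)=P_*(s)$ for all $j\in J(s)$ and all $s\in S$. For $X\in\mathbb S(p)$ let $\mathcal A(X,s)=(X_{kq})_{k,q\in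 P_*(s)}$ be the principal submatrix of $X$ on $P_*(s)$, and for $W\in\mathbb S(P_*(s))$ let $\mathcal B(W,s)\in\mathbb S(p)$ be the extension of $W$ by zeros to a $p\times p$ matrix. Then there is $\varepsilon_0>0$ such that every pair $(X,U)\in\mathbb S(p)\times\mathbb S(p)$ with $\|(X,U)-(X^0,U^0)\|\le\varepsilon_0$ belongs to $\mathbb C$ if and only if there are matrices $W(s)\in\mathbb S(P_*(s))$, $s\in S$, such that $$\mathcal A(X,s)W(s)+W(s)\mathcal A(X,s)=0\quad\forall s\in S,\qquad U=\sum_{s\in S}\mathcal B(W(s),s).$$ Here $\|(X,U)\|=(X\bullet X+U\bullet U)^{1/2}$. -/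

import Mathlib

namespace CopCP

open Matrix

/-- The trace inner product `U • W = trace (U W)`. -/
def ip {p : ℕ} (U W : Matrix (Fin p) (Fin p) ℝ) : ℝ := (U * W).trace

/-- The Euclidean norm of a pair of symmetric matrices that is induced by the trace inner product. -/
noncomputable def pairNorm {p : ℕ} (X U : Matrix (Fin p) (Fin p) ℝ) : ℝ :=
  Real.sqrt (ip X X + ip U U)

/-- The cone `COP(p)` of copositive matrices. -/
def cop (p : ℕ) : Set (Matrix (Fin p) (Fin p) ℝ) :=
  {D | D.IsSymm ∧ ∀ t : Fin p → ℝ, 0 ≤ t → 0 ≤ t ⬝ᵥ (D *ᵥ t)}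

/-- The cone `CP(p)` of completely positive matrices: the conic hull of the matrices `t tᵀ`, `t ≥ 0`.
It is the dual cone of `COP(p)`, see `cp_eq_dualCone_cop` below. -/
def cp (p : ℕ) : Set (Matrix (Fin p) (Fin p) ℝ) :=
  PointedCone.hull ℝ {M : Matrix (Fin p) (Fin p) ℝ | ∃ t : Fin p → ℝ, 0 ≤ t ∧ M = vecMulVec t t}

/-- The dual cone, in the space of symmetric matrices. -/
def dualCone {p : ℕ} (K : Set (Matrix (Fin p) (Fin p) ℝ)) : Set (Matrix (Fin p) (Fin p) ℝ) :=
  {U | U.IsSymm ∧ ∀ X ∈ K, 0 ≤ ip U X}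

/-- The complementarity set of the cone of copositive matrices. -/
def complementaritySet (p : ℕ) : Set (Matrix (Fin p) (Fin p) ℝ × Matrix (Fin p) (Fin p) ℝ) :=
  {XU | XU.1 ∈ cop p ∧ XU.2 ∈ cp p ∧ ip XU.1 XU.2 = 0}

/-- `U` is strictly complementary to `X`: it lies in the relative interior of `CP(p) ∩ Xᗮ`. -/
def IsStrictlyComplementary {p : ℕ} (U X : Matrix (Fin p) (Fin p) ℝ) : Prop :=
  U ∈ intrinsicInterior ℝ {V | V ∈ cp p ∧ ip X V = 0}

/-- The set `T_a(X)` of normalized zeros of `X`. -/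
def normalizedZeros {p : ℕ} (X : Matrix (Fin p) (Fin p) ℝ) : Set (Fin p → ℝ) :=
  {t | 0 ≤ t ∧ ∑ k, |t k| = 1 ∧ t ⬝ᵥ (X *ᵥ t) = 0}

/-- The set of vertices of `conv T_a(X)`. -/
def zeroVertices {p : ℕ} (X : Matrix (Fin p) (Fin p) ℝ) : Set (Fin p → ℝ) :=
  (convexHull ℝ (normalizedZeros X)).extremePoints ℝ

/-- `τ` lists the vertices of `conv T_a(X)`, each of them once.
Such lists exist for every copositive `X`, see `exists_isVertexList` below. -/
def IsVertexList {p n : ℕ} (X : Matrix (Fin p) (Fin p) ℝ) (τ : Fin n → Fin p → ℝ) : Prop :=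
  Function.Injective τ ∧ Set.range τ = zeroVertices X

/-- The support of a vector. -/
noncomputable def supp {p : ℕ} (t : Fin p → ℝ) : Finset (Fin p) :=
  Finset.univ.filter fun k => t k ≠ 0

/-- The index set `M(j) = {k | e_kᵀ X τ(j) = 0}`. -/
noncomputable def indexM {p n : ℕ} (X : Matrix (Fin p) (Fin p) ℝ) (τ : Fin n → Fin p → ℝ)
    (j : Fin n) : Finset (Fin p) :=
  Finset.univ.filter fun k => (X *ᵥ τ j) k = 0

/-- The union of the supports of `τ(j)`, `j ∈ I`; for `I = J(s)` this is `P_*(s)`. -/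
noncomputable def indexP {p n : ℕ} (τ : Fin n → Fin p → ℝ) (I : Finset (Fin n)) :
    Finset (Fin p) :=
  I.biUnion fun j => supp (τ j)

/-- The three conditions on a family of (possibly overlapping) subsets `J(s)` of the index set of
the vertices. -/
structure IsZeroCover {p n m : ℕ} (X : Matrix (Fin p) (Fin p) ℝ) (τ : Fin n → Fin p → ℝ)
    (J : Fin m → Finset (Fin n)) : Prop where
  cover : ∀ j, ∃ s, j ∈ J s
  supp_subset : ∀ s, ∀ i ∈ J s, indexP τ (J s) ⊆ indexM X τ i
  separated : ∀ s r, s ≠ r → (J s \ J r).Nonempty ∧ (J r \ J s).Nonempty ∧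
    ∀ i ∈ J s \ J r, ∃ j ∈ J r \ J s, ∃ k ∈ supp (τ i), k ∉ indexM X τ j

/-- A partition of the index set of the vertices into the maximum number of subsets `J(s)` that
satisfy the three conditions of `IsZeroCover`. -/
def IsZeroPartition {p n m : ℕ} (X : Matrix (Fin p) (Fin p) ℝ) (τ : Fin n → Fin p → ℝ)
    (J : Fin m → Finset (Fin n)) : Prop :=
  IsZeroCover X τ J ∧
    ∀ (m' : ℕ) (J' : Fin m' → Finset (Fin n)), IsZeroCover X τ J' → m' ≤ m

/-- `I_b ⊆ I` with `rank (τ(j), j ∈ I) = rank (τ(j), j ∈ I_b) = |I_b|`. -/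
def IsRankBasis {p n : ℕ} (τ : Fin n → Fin p → ℝ) (I Ib : Finset (Fin n)) : Prop :=
  Ib ⊆ I ∧ Set.finrank ℝ (τ '' (I : Set (Fin n))) = Set.finrank ℝ (τ '' (Ib : Set (Fin n))) ∧
    Set.finrank ℝ (τ '' (Ib : Set (Fin n))) = Ib.card

/-- `V(I)`, the set of pairs `(i, j)` with `i, j ∈ I` and `i ≤ j`. -/
def pairsV {n : ℕ} (I : Finset (Fin n)) : Finset (Fin n × Fin n) :=
  (I ×ˢ I).filter fun ij => ij.1 ≤ ij.2

/-- Non-degeneracy: the matrices `(τ(i) + τ(j)) (τ(i) + τ(j))ᵀ`, `(i, j) ∈ V(J_b(s))`, `s ∈ S`,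
are linearly independent. -/
def IsNondegenerate {p n m : ℕ} (τ : Fin n → Fin p → ℝ) (Jb : Fin m → Finset (Fin n)) : Prop :=
  LinearIndependent ℝ fun x : (Σ s : Fin m, pairsV (Jb s)) =>
    vecMulVec (τ x.2.1.1 + τ x.2.1.2) (τ x.2.1.1 + τ x.2.1.2)

/-- The principal submatrix on the rows and columns in `Q`. -/
def principal {p : ℕ} (X : Matrix (Fin p) (Fin p) ℝ) (Q : Finset (Fin p)) : Matrix Q Q ℝ :=
  X.submatrix Subtype.val Subtype.val

/-- Extension of a matrix with index set `Q` by zeros to a `p × p` matrix. -/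
def zeroPad {p : ℕ} {Q : Finset (Fin p)} (W : Matrix Q Q ℝ) : Matrix (Fin p) (Fin p) ℝ :=
  Matrix.of fun k q => if h : k ∈ Q ∧ q ∈ Q then W ⟨k, h.1⟩ ⟨q, h.2⟩ else 0

theorem isSymm_of_mem_cp {p : ℕ} {U : Matrix (Fin p) (Fin p) ℝ} (hU : U ∈ cp p) : U.IsSymm := by
  refine Submodule.span_induction (p := fun M _ => M.IsSymm) ?_ ?_ ?_ ?_ hU
  · rintro M ⟨t, -, rfl⟩
    exact Matrix.transpose_vecMulVec t t
  · exact Matrix.isSymm_zero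
  · intro A B _ _ hA hB
    exact hA.add hB
  · intro c A _ hA
    change (c • A)ᵀ = c • A
    rw [Matrix.transpose_smul, hA]

theorem ip_vecMulVec {p : ℕ} (t : Fin p → ℝ) (X : Matrix (Fin p) (Fin p) ℝ) :
    ip (vecMulVec t t) X = t ⬝ᵥ (X *ᵥ t) := by
  rw [ip, Matrix.trace_mul_comm, Matrix.mul_vecMulVec, Matrix.trace_vecMulVec, dotProduct_comm]

open scoped Pointwise in
theorem mem_cp_iff {p : ℕ} {U : Matrix (Fin p) (Fin p) ℝ} :
    U ∈ cp p ↔ ∃ B : Fin (Module.finrank ℝ (Matrix (Fin p) (Fin p) ℝ) + 1) → Fin p → ℝ,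
      0 ≤ B ∧ U = ∑ i, vecMulVec (B i) (B i) := by
  constructor
  · intro hU
    have hU' : U ∈ convexHull ℝ {M : Matrix (Fin p) (Fin p) ℝ |
        ∃ t : Fin p → ℝ, 0 ≤ t ∧ M = vecMulVec t t} := by
      set S := {M : Matrix (Fin p) (Fin p) ℝ | ∃ t : Fin p → ℝ, 0 ≤ t ∧ M = vecMulVec t t} with hS
      have hsm : ∀ (c : ℝ), 0 ≤ c → ∀ M ∈ convexHull ℝ S, c • M ∈ convexHull ℝ S := by
        intro c hc M hM
        have h1 : c • M ∈ convexHull ℝ (c • S) := by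
          rw [convexHull_smul]
          exact Set.smul_mem_smul_set hM
        refine convexHull_mono ?_ h1
        rintro _ ⟨_, ⟨t, ht, rfl⟩, rfl⟩
        refine ⟨Real.sqrt c • t, smul_nonneg (Real.sqrt_nonneg c) ht, ?_⟩
        simp only [Matrix.smul_vecMulVec, Matrix.vecMulVec_smul, smul_smul, Real.mul_self_sqrt hc]
      refine Submodule.span_induction (p := fun M _ => M ∈ convexHull ℝ S) ?_ ?_ ?_ ?_ hU
      · intro M hM
        exact subset_convexHull ℝ S hM
      · refine subset_convexHull ℝ S ⟨0, le_rfl, by simp⟩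
      · intro A B _ _ hA hB
        have h2 : (2 : ℝ) • ((1 / 2 : ℝ) • A + (1 / 2 : ℝ) • B) ∈ convexHull ℝ S :=
          hsm 2 (by norm_num) _ ((convex_convexHull ℝ S) hA hB (by norm_num) (by norm_num)
            (by norm_num))
        rw [smul_add, smul_smul, smul_smul] at h2
        norm_num at h2
        exact h2
      · intro c A _ hA
        exact hsm c c.2 A hA
    obtain ⟨ι, _, z, w, hz, hai, hw, -, hx⟩ := eq_pos_convex_span_of_mem_convexHull hU'
    have hcard : Fintype.card ι ≤
        Fintype.card (Fin (Module.finrank ℝ (Matrix (Fin p) (Fin p) ℝ) + 1)) := by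
      rw [Fintype.card_fin]
      refine hai.card_le_finrank_succ.trans ?_
      exact Nat.add_le_add_right (Submodule.finrank_le _) 1
    obtain ⟨e⟩ := Function.Embedding.nonempty_of_card_le hcard
    have hz' : ∀ i, ∃ t : Fin p → ℝ, 0 ≤ t ∧ z i = vecMulVec t t := fun i => hz ⟨i, rfl⟩
    choose t ht hzt using hz'
    refine ⟨fun k => if h : ∃ i, e i = k then Real.sqrt (w h.choose) • t h.choose else 0, ?_, ?_⟩
    · intro k
      dsimp only
      split_ifs with h
      · exact smul_nonneg (Real.sqrt_nonneg _) (ht _)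
      · exact le_rfl
    · rw [← hx]
      refine Fintype.sum_of_injective e e.injective _ _ ?_ ?_
      · intro k hk
        have hk' : ¬ ∃ i, e i = k := hk
        simp [hk']
      · intro i
        have h : ∃ j, e j = e i := ⟨i, rfl⟩
        have hc : h.choose = i := e.injective h.choose_spec
        simp only [h, dif_pos, hc, hzt, Matrix.smul_vecMulVec, Matrix.vecMulVec_smul, smul_smul,
          Real.mul_self_sqrt (hw i).le]
  · rintro ⟨B, hB, rfl⟩
    exact Submodule.sum_mem _ fun i _ => Submodule.subset_span ⟨B i, hB i, rfl⟩

theorem isClosed_cp (p : ℕ) : IsClosed (cp p) := by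
  have : SequentialSpace (Matrix (Fin p) (Fin p) ℝ) :=
    inferInstanceAs (SequentialSpace (Fin p → Fin p → ℝ))
  refine IsSeqClosed.isClosed ?_
  intro u U hu hlim
  have h := fun k => mem_cp_iff.1 (hu k)
  choose B hB huB using h
  have hbd : ∀ j, ∃ c, ∀ k, u k j j ≤ c := by
    intro j
    have hc : Continuous fun M : Matrix (Fin p) (Fin p) ℝ => M j j := by fun_prop
    obtain ⟨c, hc⟩ := ((hc.tendsto U).comp hlim).bddAbove_range
    exact ⟨c, fun k => hc ⟨k, rfl⟩⟩
  choose C hC using hbd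
  have hent : ∀ k i j, B k i j ∈ Set.Icc (0 : ℝ) (Real.sqrt (C j)) := by
    intro k i j
    refine ⟨hB k i j, Real.le_sqrt_of_sq_le ?_⟩
    have h1 : u k j j = ∑ i, B k i j * B k i j := by
      rw [huB k, Matrix.sum_apply]
      rfl
    have h2 : B k i j * B k i j ≤ u k j j := by
      rw [h1]
      exact Finset.single_le_sum (f := fun i => B k i j * B k i j)
        (fun i _ => mul_self_nonneg _) (Finset.mem_univ i)
    have h3 := hC j k
    nlinarith
  have hcomp : IsCompact (Set.univ.pi fun _ => Set.univ.pi fun j => Set.Icc (0 : ℝ) (Real.sqrt (C j)) :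
      Set (Fin (Module.finrank ℝ (Matrix (Fin p) (Fin p) ℝ) + 1) → Fin p → ℝ)) :=
    isCompact_univ_pi fun _ => isCompact_univ_pi fun _ => isCompact_Icc
  obtain ⟨B₀, hB₀, φ, hφ, hφlim⟩ := hcomp.tendsto_subseq
    (x := B) (fun k i _ j _ => hent k i j)
  refine mem_cp_iff.2 ⟨B₀, fun i j => (hB₀ i trivial j trivial).1, ?_⟩
  have hcont : Continuous fun A : Fin (Module.finrank ℝ (Matrix (Fin p) (Fin p) ℝ) + 1) →
      Fin p → ℝ => ∑ i, vecMulVec (A i) (A i) := by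
    refine continuous_finsetSum _ fun i _ => ?_
    exact (continuous_apply i).matrix_vecMulVec (continuous_apply i)
  refine tendsto_nhds_unique (hlim.comp hφ.tendsto_atTop) ?_
  have := (hcont.tendsto B₀).comp hφlim
  refine this.congr fun k => ?_
  simp [huB]

/-- The cones of copositive and of completely positive matrices: the latter is the dual cone of the
former. -/
theorem cp_eq_dualCone_cop (p : ℕ) : cp p = dualCone (cop p) := by
  have : LocallyConvexSpace ℝ (Matrix (Fin p) (Fin p) ℝ) :=
    inferInstanceAs (LocallyConvexSpace ℝ (Fin p → Fin p → ℝ))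
  apply Set.Subset.antisymm
  · intro U hU
    refine ⟨isSymm_of_mem_cp hU, fun X hX => ?_⟩
    obtain ⟨B, hB, rfl⟩ := mem_cp_iff.1 hU
    have : ip (∑ i, vecMulVec (B i) (B i)) X = ∑ i, ip (vecMulVec (B i) (B i)) X := by
      simp only [ip, Finset.sum_mul, Matrix.trace_sum]
    rw [this]
    refine Finset.sum_nonneg fun i _ => ?_
    rw [ip_vecMulVec]
    exact hX.2 _ (hB i)
  · rintro U ⟨hUs, hU⟩
    by_contra hcon
    have hconv : Convex ℝ (cp p) := PointedCone.convex _
    obtain ⟨f, c, hfU, hf⟩ := geometric_hahn_banach_point_closed hconv (isClosed_cp p) hcon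
    have h0 : (0 : Matrix (Fin p) (Fin p) ℝ) ∈ cp p := Submodule.zero_mem _
    have hc : c < 0 := by simpa using hf 0 h0
    have hfn : ∀ V ∈ cp p, 0 ≤ f V := by
      intro V hV
      by_contra! hneg
      have hmem : (c / f V) • V ∈ cp p :=
        PointedCone.smul_mem _ (div_nonneg_of_nonpos hc.le hneg.le) hV
      have := hf _ hmem
      rw [map_smul, smul_eq_mul, div_mul_cancel₀ _ hneg.ne] at this
      exact lt_irrefl _ this
    let Y : Matrix (Fin p) (Fin p) ℝ := Matrix.of fun i j => f (Matrix.single j i 1)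
    have hfY : ∀ V, f V = ip V Y := by
      intro V
      conv_lhs => rw [Matrix.matrix_eq_sum_single V]
      simp only [map_sum, ip, Matrix.trace, Matrix.diag, Matrix.mul_apply]
      refine Finset.sum_congr rfl fun i _ => Finset.sum_congr rfl fun j _ => ?_
      have : Matrix.single i j (V i j) = V i j • Matrix.single i j (1 : ℝ) := by
        simp [Matrix.smul_single]
      rw [this, map_smul]
      rfl
    have hsym : ∀ V : Matrix (Fin p) (Fin p) ℝ, V.IsSymm → ip V (Y + Yᵀ) = 2 * f V := by
      intro V hV
      have h1 : ip V Yᵀ = ip V Y := by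
        unfold ip
        rw [← Matrix.trace_transpose, Matrix.transpose_mul, Matrix.transpose_transpose, hV,
          Matrix.trace_mul_comm]
      have h2 : ip V (Y + Yᵀ) = ip V Y + ip V Yᵀ := by
        simp only [ip, Matrix.mul_add, Matrix.trace_add]
      rw [h2, h1, hfY]
      ring
    have hD : Y + Yᵀ ∈ cop p := by
      refine ⟨Matrix.isSymm_add_transpose_self Y, fun t ht => ?_⟩
      have hm : vecMulVec t t ∈ cp p := Submodule.subset_span ⟨t, ht, rfl⟩
      rw [← ip_vecMulVec, hsym _ (isSymm_of_mem_cp hm)]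
      have := hfn _ hm
      linarith
    have := hU _ hD
    rw [hsym U hUs] at this
    linarith

theorem mulVec_nonneg_of_zero {p : ℕ} {X : Matrix (Fin p) (Fin p) ℝ} (hX : X ∈ cop p)
    {t : Fin p → ℝ} (ht : t ∈ normalizedZeros X) (k : Fin p) : 0 ≤ (X *ᵥ t) k := by
  obtain ⟨h0, -, hz⟩ := ht
  by_contra! hneg
  have hsw : t ⬝ᵥ (X *ᵥ Pi.single k 1) = (X *ᵥ t) k := by
    rw [Matrix.dotProduct_mulVec, ← Matrix.mulVec_transpose, hX.1]
    simp
  have key : ∀ δ : ℝ, 0 ≤ δ → 0 ≤ 2 * δ * (X *ᵥ t) k + δ ^ 2 * X k k := by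
    intro δ hδ
    have hs : (0 : Fin p → ℝ) ≤ Pi.single k 1 := by
      intro i
      by_cases hi : i = k
      · subst hi
        simp
      · simp [hi]
    have := hX.2 (t + δ • Pi.single k 1) (add_nonneg h0 (smul_nonneg hδ hs))
    simp only [Matrix.mulVec_add, Matrix.mulVec_smul, add_dotProduct, dotProduct_add,
      smul_dotProduct, dotProduct_smul, hz, hsw, smul_eq_mul] at this
    simp at this
    nlinarith
  have hk : 0 ≤ X k k := by
    by_contra! hh
    have := key 1 zero_le_one
    linarith
  have h1 := key (-(X *ᵥ t) k / (X k k + 1)) (div_nonneg (by linarith) (by linarith))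
  set a := -(X *ᵥ t) k with ha
  have ha0 : 0 < a := by linarith
  set d := a / (X k k + 1) with hd
  have hda : d * (X k k + 1) = a := div_mul_cancel₀ _ (by linarith)
  have hd0 : 0 < d := div_pos ha0 (by linarith)
  have hXt : (X *ᵥ t) k = -a := by simp [ha]
  rw [hXt] at h1
  nlinarith [mul_pos hd0 ha0, mul_pos hd0 hd0]

theorem eq_of_supp_eq {p : ℕ} {X : Matrix (Fin p) (Fin p) ℝ} (hX : X ∈ cop p)
    {t t' : Fin p → ℝ} (ht : t ∈ zeroVertices X) (ht' : t' ∈ zeroVertices X)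
    (h : supp t = supp t') : t = t' := by
  have hz := extremePoints_convexHull_subset ht
  have hz' := extremePoints_convexHull_subset ht'
  have hiff : ∀ k, t k ≠ 0 ↔ t' k ≠ 0 := by
    intro k
    have := Finset.ext_iff.1 h k
    simpa [supp] using this
  have hcs : ∀ k, t k * (X *ᵥ t) k = 0 := by
    have hs : ∑ k, t k * (X *ᵥ t) k = 0 := hz.2.2
    have := (Finset.sum_eq_zero_iff_of_nonneg
      (fun k _ => mul_nonneg (hz.1 k) (mulVec_nonneg_of_zero hX hz k))).1 hs
    exact fun k => this k (Finset.mem_univ k)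
  have hcross : t' ⬝ᵥ (X *ᵥ t) = 0 := by
    refine Finset.sum_eq_zero fun k _ => ?_
    by_cases hk : t k = 0
    · have : t' k = 0 := by
        by_contra hne
        exact (hiff k).2 hne hk
      rw [this, zero_mul]
    · rw [(mul_eq_zero.1 (hcs k)).resolve_left hk, mul_zero]
  have hcross' : t ⬝ᵥ (X *ᵥ t') = 0 := by
    rw [Matrix.dotProduct_mulVec, ← Matrix.mulVec_transpose, hX.1, dotProduct_comm, hcross]
  have hev : ∀ᶠ δ in nhdsWithin (0 : ℝ) (Set.Ioi 0), ∀ k, 0 ≤ t k + δ * (t k - t' k) := by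
    rw [Filter.eventually_all]
    intro k
    by_cases hk : t k = 0
    · have : t' k = 0 := by
        by_contra hne
        exact (hiff k).2 hne hk
      simp [hk, this]
    · have hpos : 0 < t k := lt_of_le_of_ne (hz.1 k) (Ne.symm hk)
      have hc : Continuous fun δ : ℝ => t k + δ * (t k - t' k) := by fun_prop
      have := (hc.tendsto 0).mono_left (nhdsWithin_le_nhds (s := Set.Ioi 0))
      have h2 := this.eventually (lt_mem_nhds (a := 0) (by simpa using hpos))
      exact h2.mono fun δ hδ => hδ.le
  obtain ⟨δ, hδ, hδ0⟩ := (hev.and self_mem_nhdsWithin).exists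
  have hδ0 : 0 < δ := hδ0
  have hsum : ∀ {v : Fin p → ℝ}, 0 ≤ v → ∑ k, |v k| = ∑ k, v k := fun hv =>
    Finset.sum_congr rfl fun k _ => abs_of_nonneg (hv k)
  have hy0 : 0 ≤ t + δ • (t - t') := fun k => by simpa using hδ k
  have hy : t + δ • (t - t') ∈ normalizedZeros X := by
    refine ⟨hy0, ?_, ?_⟩
    · rw [hsum hy0]
      have h1 := hz.2.1
      have h2 := hz'.2.1
      rw [hsum hz.1] at h1
      rw [hsum hz'.1] at h2
      simp [Finset.sum_add_distrib, ← Finset.mul_sum, h1, h2]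
    · simp only [Matrix.mulVec_add, Matrix.mulVec_smul, Matrix.mulVec_sub, add_dotProduct,
        dotProduct_add, sub_dotProduct, dotProduct_sub, smul_dotProduct, dotProduct_smul, hcross,
        hcross', hz.2.2, hz'.2.2]
      simp
  have := (mem_extremePoints.1 ht).2 _ (subset_convexHull ℝ _ hy) t' (subset_convexHull ℝ _ hz')
    ⟨1 / (1 + δ), δ / (1 + δ), by positivity, by positivity, by field_simp, by
      ext k
      simp
      field_simp
      ring⟩
  exact this.2.symm

theorem finite_zeroVertices {p : ℕ} {X : Matrix (Fin p) (Fin p) ℝ} (hX : X ∈ cop p) :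
    (zeroVertices X).Finite :=
  Set.Finite.of_finite_image (f := supp) (Set.toFinite _)
    fun _ ht _ ht' h => eq_of_supp_eq hX ht ht' h

/-- The vertices of `conv T_a(X)` can be listed. -/
theorem exists_isVertexList {p : ℕ} {X : Matrix (Fin p) (Fin p) ℝ} (hX : X ∈ cop p) :
    ∃ (n : ℕ) (τ : Fin n → Fin p → ℝ), IsVertexList X τ := by
  obtain ⟨n, τ, h1, h2⟩ := (finite_zeroVertices hX).fin_param
  exact ⟨n, τ, h1, h2⟩

/-- Partitions as in `IsZeroPartition` exist. -/
theorem exists_isZeroPartition {p n : ℕ} {X : Matrix (Fin p) (Fin p) ℝ} (hX : X ∈ cop p)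
    {τ : Fin n → Fin p → ℝ} (hτ : IsVertexList X τ) :
    ∃ (m : ℕ) (J : Fin m → Finset (Fin n)), IsZeroPartition X τ J := by
  classical
  have hz : ∀ j, τ j ∈ normalizedZeros X := fun j =>
    extremePoints_convexHull_subset (hτ.2 ▸ Set.mem_range_self j)
  have hcross : ∀ i j, supp (τ i) ⊆ indexM X τ j ↔ τ i ⬝ᵥ (X *ᵥ τ j) = 0 := by
    intro i j
    have hnn : ∀ k ∈ Finset.univ, 0 ≤ τ i k * (X *ᵥ τ j) k := fun k _ =>
      mul_nonneg ((hz i).1 k) (mulVec_nonneg_of_zero hX (hz j) k)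
    have hs := Finset.sum_eq_zero_iff_of_nonneg hnn
    constructor
    · intro h
      refine hs.2 fun k _ => ?_
      by_cases hk : τ i k = 0
      · rw [hk, zero_mul]
      · have : k ∈ indexM X τ j := h (by simp [supp, hk])
        have h2 : (X *ᵥ τ j) k = 0 := by simpa [indexM] using this
        rw [h2, mul_zero]
    · intro h k hk
      have h1 := hs.1 h k (Finset.mem_univ k)
      have h2 : τ i k ≠ 0 := by simpa [supp] using hk
      simpa [indexM] using (mul_eq_zero.1 h1).resolve_left h2
  have hsymm : ∀ i j, supp (τ i) ⊆ indexM X τ j → supp (τ j) ⊆ indexM X τ i := by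
    intro i j h
    rw [hcross] at h ⊢
    rw [Matrix.dotProduct_mulVec, ← Matrix.mulVec_transpose, hX.1, dotProduct_comm, h]
  have hself : ∀ i, supp (τ i) ⊆ indexM X τ i := fun i => (hcross i i).2 (hz i).2.2
  let Cl : Finset (Fin n) → Prop := fun I => ∀ i ∈ I, ∀ j ∈ I, supp (τ i) ⊆ indexM X τ j
  let F : Finset (Finset (Fin n)) := Finset.univ.filter fun I => Maximal Cl I
  have hF : ∀ I, I ∈ F ↔ Maximal Cl I := fun I => by simp [F]
  have hex : ∃ (m : ℕ) (J : Fin m → Finset (Fin n)), IsZeroCover X τ J := by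
    refine ⟨F.card, fun s => (F.equivFin.symm s).1, ?_, ?_, ?_⟩
    · intro j
      have hj : Cl {j} := by
        intro a ha b hb
        rw [Finset.mem_singleton.1 ha, Finset.mem_singleton.1 hb]
        exact hself j
      obtain ⟨I, hI, hmax⟩ := (Set.toFinite {I | Cl I}).exists_le_maximal hj
      refine ⟨F.equivFin ⟨I, (hF I).2 hmax⟩, ?_⟩
      rw [Equiv.symm_apply_apply]
      exact hI (Finset.mem_singleton_self j)
    · intro s i hi
      have hmax := (hF _).1 (F.equivFin.symm s).2
      refine Finset.biUnion_subset.2 fun j hj => ?_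
      exact hmax.1 j hj i hi
    · intro s r hsr
      have hms := (hF _).1 (F.equivFin.symm s).2
      have hmr := (hF _).1 (F.equivFin.symm r).2
      have hne : (F.equivFin.symm s).1 ≠ (F.equivFin.symm r).1 := fun h =>
        hsr (F.equivFin.symm.injective (Subtype.ext h))
      refine ⟨?_, ?_, ?_⟩
      · rw [Finset.sdiff_nonempty]
        exact fun h => hne (hms.eq_of_le hmr.1 h)
      · rw [Finset.sdiff_nonempty]
        exact fun h => hne (hmr.eq_of_le hms.1 h).symm
      · intro i hi
        rw [Finset.mem_sdiff] at hi
        by_contra! hcon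
        have hadj : ∀ j ∈ (F.equivFin.symm r).1, supp (τ i) ⊆ indexM X τ j := by
          intro j hj
          by_cases hjs : j ∈ (F.equivFin.symm s).1
          · exact hms.1 i hi.1 j hjs
          · exact fun k hk => hcon j (Finset.mem_sdiff.2 ⟨hj, hjs⟩) k hk
        have hcl : Cl (insert i (F.equivFin.symm r).1) := by
          intro a ha b hb
          rcases Finset.mem_insert.1 ha with ha | ha
          · rw [ha]
            rcases Finset.mem_insert.1 hb with hb | hb
            · rw [hb]
              exact hself _
            · exact hadj b hb
          · rcases Finset.mem_insert.1 hb with hb | hb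
            · rw [hb]
              exact hsymm _ _ (hadj a ha)
            · exact hmr.1 a ha b hb
        have := hmr.eq_of_le hcl (Finset.subset_insert _ _)
        exact hi.2 (this ▸ Finset.mem_insert_self _ _)
  have hbd : ∀ m, (∃ J : Fin m → Finset (Fin n), IsZeroCover X τ J) →
      m ≤ Fintype.card (Finset (Fin n)) := by
    rintro m ⟨J, hJ⟩
    have hinj : Function.Injective J := by
      intro s r h
      by_contra hne
      have := (hJ.separated s r hne).1
      simp [h] at this
    simpa using Fintype.card_le_of_injective J hinj
  obtain ⟨m₀, hm₀⟩ := hex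
  have hfin : {m | ∃ J : Fin m → Finset (Fin n), IsZeroCover X τ J}.Finite :=
    (Set.finite_Iic (Fintype.card (Finset (Fin n)))).subset hbd
  obtain ⟨m, ⟨J, hJ⟩, hmax⟩ := hfin.exists_maximal ⟨m₀, hm₀⟩
  refine ⟨m, J, hJ, fun m' J' hJ' => ?_⟩
  by_contra! hlt
  exact absurd (hmax ⟨J', hJ'⟩ hlt.le) (by omega)

end CopCP

open CopCP

/-!
Let `P s` be the index set of the block `J s`, and let `A₀ = principal X₀ (P s)`. The sum of the
vertices in `J s` is an entrywise positive zero of the copositive matrix `A₀`, which is therefore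
positive semidefinite (`posSemidef_of_pos_zero`). By the Krein–Milman theorem and since the `J s`
are maximal cliques for the relation `τ i ⬝ᵥ (X₀ *ᵥ τ j) = 0`, every zero `t ≥ 0` of `X₀` lies in
the cone over one `J s`, and the equality of `indexM` with `P s` makes `X₀ t` vanish exactly on
`P s` (`exists_block_of_zero`). Hence `ker A₀` is spanned by the vertices of the block, and
nondegeneracy says that the spaces of symmetric matrices on these kernels are independent, so that
the decomposition `U₀ = ∑ s, zeroPad (W₀ s)` with `A₀ W₀ = 0` is unique
(`IsNondegenerate.eq_zero_of_sum_eq_zero`). Strict complementarity allows one to take `W₀ s` as a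
sum of matrices `a aᵀ` with entrywise positive vectors `a` that span `ker A₀`
(`IsStrictlyComplementary.exists_blocks`).

By uniqueness and compactness, the blocks `W s` of a nearby `U` are near `W₀ s`, both for
solutions of the Lyapunov equations and for decompositions of completely positive matrices. The
core is then a statement on a single block with `(A, W)` near `(A₀, W₀)`. A Schur complement and
the inverse function theorem write `W` as a sum of `a aᵀ` with vectors `a > 0` near those of `W₀`,
plus a remainder `R` annihilated by a matrix that is injective on `ker A₀`
(`HasPositiveFactorization.eventually_split`).
* If `A W + W A = 0`, then an eigenvector of `A` with negative eigenvalue would contradict the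
  positive definiteness of `A + W`; so `A` is positive semidefinite, `A W = 0`, and `R = 0`. Thus
  `W` is completely positive (`HasPositiveFactorization.eventually_of_lyapunov`).
* If `A` is copositive, `W` is positive semidefinite and `A • W = 0`, then the positive vectors
  `a` are zeros of `A`, so `A` is positive semidefinite and `A W = 0`
  (`HasPositiveFactorization.eventually_mul_eq_zero`).

Finally, compactness of the simplex shows that a matrix near `X₀` with positive semidefinite
blocks is copositive (`eventually_mem_cop`), and that the zeros of a copositive matrix near `X₀`
are supported in the sets `P s` (`eventually_supp_subset`).
-/

namespace CopCP

open Matrix Filter Topology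

/-! ### Positive semidefinite matrices and their perturbations -/

section LinearAlgebra

variable {Q : Type*} [Fintype Q]

theorem dotProduct_mulVec_symm {A : Matrix Q Q ℝ} (hA : A.IsSymm) (x y : Q → ℝ) :
    x ⬝ᵥ (A *ᵥ y) = y ⬝ᵥ (A *ᵥ x) := by
  rw [Matrix.dotProduct_mulVec, ← Matrix.mulVec_transpose, hA, dotProduct_comm]

theorem posSemidef_iff_real {A : Matrix Q Q ℝ} :
    A.PosSemidef ↔ A.IsSymm ∧ ∀ x, 0 ≤ x ⬝ᵥ (A *ᵥ x) := by
  simp [posSemidef_iff_dotProduct_mulVec, IsHermitian, IsSymm]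

theorem trace_mul_vecMulVec_self (A : Matrix Q Q ℝ) (x : Q → ℝ) :
    (A * vecMulVec x x).trace = x ⬝ᵥ (A *ᵥ x) := by
  rw [Matrix.mul_vecMulVec, Matrix.trace_vecMulVec, dotProduct_comm]

theorem mulVec_eq_zero_of_posSemidef {A : Matrix Q Q ℝ} (hA : A.PosSemidef) {x : Q → ℝ}
    (hx : x ⬝ᵥ (A *ᵥ x) = 0) : A *ᵥ x = 0 := by
  simpa using (hA.dotProduct_mulVec_zero_iff x).1 (by simpa using hx)

theorem trace_mul_nonneg_of_posSemidef {A B : Matrix Q Q ℝ} (hA : A.PosSemidef)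
    (hB : B.PosSemidef) : 0 ≤ (A * B).trace := by
  obtain ⟨k, b, rfl⟩ := posSemidef_iff_eq_sum_vecMulVec.1 hB
  simp only [star_trivial, Finset.mul_sum, trace_sum, trace_mul_vecMulVec_self]
  exact Finset.sum_nonneg fun i _ => (posSemidef_iff_real.1 hA).2 _

theorem mul_eq_zero_of_trace_eq_zero {A B : Matrix Q Q ℝ} (hA : A.PosSemidef)
    (hB : B.PosSemidef) (h : (A * B).trace = 0) : A * B = 0 := by
  obtain ⟨k, b, rfl⟩ := posSemidef_iff_eq_sum_vecMulVec.1 hB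
  simp only [star_trivial, Finset.mul_sum, trace_sum, trace_mul_vecMulVec_self] at h ⊢
  refine Finset.sum_eq_zero fun i hi => ?_
  have := (Finset.sum_eq_zero_iff_of_nonneg
    (fun i _ => (posSemidef_iff_real.1 hA).2 _)).1 h i hi
  rw [mul_vecMulVec, mulVec_eq_zero_of_posSemidef hA this, zero_vecMulVec]

/-- A symmetric solution `W` of the Lyapunov equation `A W + W A = 0` with positive semidefinite
`A` satisfies `A W = 0`, because `W A W` is positive semidefinite with trace zero. -/
theorem mul_eq_zero_of_lyapunov {A W : Matrix Q Q ℝ} (hA : A.PosSemidef) (hW : W.IsSymm)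
    (h : A * W + W * A = 0) : A * W = 0 := by
  have hAW : A * W = -(W * A) := eq_neg_of_add_eq_zero_left h
  have htr : (A * (W * Wᴴ)).trace = 0 := by
    have h1 : (A * (W * W)).trace = -(A * (W * W)).trace := by
      conv_lhs => rw [← Matrix.mul_assoc, hAW, Matrix.neg_mul, trace_neg, Matrix.trace_mul_comm,
        ← Matrix.mul_assoc, Matrix.trace_mul_comm]
    rw [conjTranspose_eq_transpose_of_trivial, hW.eq]
    linarith
  have h0 := mul_eq_zero_of_trace_eq_zero hA (posSemidef_self_mul_conjTranspose W) htr
  rw [← self_mul_conjTranspose_eq_zero, conjTranspose_mul, ← Matrix.mul_assoc, Matrix.mul_assoc A,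
    h0, Matrix.zero_mul]

theorem exists_pos_add_smul {ι : Type*} [Finite ι] {a : Q → ℝ} (ha : ∀ k, 0 < a k)
    (v : ι → Q → ℝ) : ∃ η : ℝ, 0 < η ∧ ∀ i k, 0 < a k + η * v i k := by
  have hev : ∀ᶠ η in 𝓝[>] (0 : ℝ), ∀ i k, 0 < a k + η * v i k := by
    rw [eventually_all]
    intro i
    rw [eventually_all]
    intro k
    have hc : Continuous fun η : ℝ => a k + η * v i k := by fun_prop
    exact ((hc.tendsto 0).mono_left nhdsWithin_le_nhds).eventually
      (lt_mem_nhds (by simpa using ha k))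
  obtain ⟨η, h, h0⟩ := (hev.and self_mem_nhdsWithin).exists
  exact ⟨η, h0, h⟩

/-- A copositive matrix with an entrywise positive zero is positive semidefinite. -/
theorem posSemidef_of_pos_zero {A : Matrix Q Q ℝ} (hA : A.IsSymm)
    (hcop : ∀ x, 0 ≤ x → 0 ≤ x ⬝ᵥ (A *ᵥ x)) {a : Q → ℝ} (ha : ∀ k, 0 < a k)
    (h0 : a ⬝ᵥ (A *ᵥ a) = 0) : A.PosSemidef := by
  refine posSemidef_iff_real.2 ⟨hA, fun x => ?_⟩
  obtain ⟨η, hη, h⟩ := exists_pos_add_smul ha ![x, -x]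
  have h1 := hcop (a + η • x) fun k => (h 0 k).le
  have h2 := hcop (a - η • x) fun k => by simpa [sub_eq_add_neg] using (h 1 k).le
  simp only [mulVec_add, mulVec_sub, mulVec_smul, add_dotProduct, dotProduct_add, sub_dotProduct,
    dotProduct_sub, smul_dotProduct, dotProduct_smul, smul_eq_mul, h0] at h1 h2
  have h3 : 0 ≤ (η * η) * (x ⬝ᵥ (A *ᵥ x)) := by linarith
  exact nonneg_of_mul_nonneg_right h3 (mul_pos hη hη)

/-- The kernel of `A` is the range of an injective matrix `Z`, and `L` is a left inverse of `Z`. -/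
theorem exists_kernelMatrix [DecidableEq Q] (A : Matrix Q Q ℝ) :
    ∃ (d : ℕ) (Z : Matrix Q (Fin d) ℝ) (L : Matrix (Fin d) Q ℝ),
      A * Z = 0 ∧ L * Z = 1 ∧ ∀ x, A *ᵥ x = 0 → Z *ᵥ (L *ᵥ x) = x := by
  let K := LinearMap.ker A.mulVecLin
  let b := Module.finBasis ℝ K
  let f : (Fin (Module.finrank ℝ K) → ℝ) →ₗ[ℝ] (Q → ℝ) :=
    K.subtype ∘ₗ b.equivFun.symm.toLinearMap
  have hf : LinearMap.ker f = ⊥ := by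
    rw [LinearMap.ker_eq_bot]
    exact K.injective_subtype.comp b.equivFun.symm.injective
  obtain ⟨g, hg⟩ := f.exists_leftInverse_of_injective hf
  have hLZ : LinearMap.toMatrix' g * LinearMap.toMatrix' f = 1 := by
    rw [← LinearMap.toMatrix'_comp, hg, LinearMap.toMatrix'_id]
  refine ⟨_, LinearMap.toMatrix' f, LinearMap.toMatrix' g, ?_, hLZ, ?_⟩
  · refine Matrix.toLin'.injective (LinearMap.ext fun y => ?_)
    rw [Matrix.toLin'_mul, Matrix.toLin'_toMatrix', map_zero]
    exact (b.equivFun.symm y).2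
  · intro x hx
    have hfx : f (b.equivFun ⟨x, hx⟩) = x := by simp [f]
    rw [← hfx, LinearMap.toMatrix'_mulVec, LinearMap.toMatrix'_mulVec, ← LinearMap.comp_apply g f,
      hg]
    rfl

/-- Positive definiteness is stable under small perturbations. -/
theorem eventually_forall_pos {M₀ : Matrix Q Q ℝ} (h : ∀ x, x ≠ 0 → 0 < x ⬝ᵥ (M₀ *ᵥ x)) :
    ∀ᶠ M in 𝓝 M₀, ∀ x, x ≠ 0 → 0 < x ⬝ᵥ (M *ᵥ x) := by
  have key : ∀ᶠ M in 𝓝 M₀, ∀ x ∈ Metric.sphere (0 : Q → ℝ) 1, 0 < x ⬝ᵥ (M *ᵥ x) := by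
    refine (isCompact_sphere (0 : Q → ℝ) 1).eventually_forall_of_forall_eventually ?_
    intro x hx
    have hc : Continuous fun z : Matrix Q Q ℝ × (Q → ℝ) => z.2 ⬝ᵥ (z.1 *ᵥ z.2) := by fun_prop
    refine (hc.tendsto (M₀, x)).eventually (lt_mem_nhds (h x ?_))
    rintro rfl
    simp at hx
  filter_upwards [key] with M hM x hx
  have hn : 0 < ‖x‖ := norm_pos_iff.2 hx
  have := hM (‖x‖⁻¹ • x) (by simp [norm_smul, hn.ne'])
  rw [mulVec_smul, dotProduct_smul, smul_dotProduct, smul_eq_mul, smul_eq_mul] at this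
  have h2 := mul_pos (mul_pos hn hn) this
  have h3 : ‖x‖ * ‖x‖ * (‖x‖⁻¹ * (‖x‖⁻¹ * (x ⬝ᵥ (M *ᵥ x)))) = x ⬝ᵥ (M *ᵥ x) := by
    field_simp
  rwa [h3] at h2

end LinearAlgebra

open scoped Matrix.Norms.Operator in
/-- Symmetric matrices near an invertible symmetric `u` are congruent to `u` through matrices near
the identity. The antisymmetric correction `k - kᵀ` makes the derivative surjective onto all
matrices, so that the open mapping form of the inverse function theorem applies; it vanishes for
symmetric right-hand sides. -/
theorem eventually_exists_congruence {d : Type*} [Fintype d] [DecidableEq d] {u : Matrix d d ℝ}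
    (hu : IsUnit u.det) (hsymm : u.IsSymm) {O : Set (Matrix d d ℝ)} (hO : O ∈ 𝓝 1) :
    ∀ᶠ w in 𝓝 u, w.IsSymm → ∃ m ∈ O, m * u * mᵀ = w := by
  let T : Matrix d d ℝ →L[ℝ] Matrix d d ℝ :=
    LinearMap.toContinuousLinearMap (Matrix.transposeLinearEquiv d d ℝ ℝ).toLinearMap
  let Fst : Matrix d d ℝ × Matrix d d ℝ →L[ℝ] Matrix d d ℝ := ContinuousLinearMap.fst ℝ _ _
  let Snd : Matrix d d ℝ × Matrix d d ℝ →L[ℝ] Matrix d d ℝ := ContinuousLinearMap.snd ℝ _ _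
  let Mu : Matrix d d ℝ →L[ℝ] Matrix d d ℝ := (ContinuousLinearMap.mul ℝ (Matrix d d ℝ)).flip u
  let z₀ : Matrix d d ℝ × Matrix d d ℝ := (1, 0)
  have hder := (((Mu ∘L Fst).hasStrictFDerivAt (x := z₀)).mul'
    ((T ∘L Fst).hasStrictFDerivAt (x := z₀))).add
    ((Snd - T ∘L Snd).hasStrictFDerivAt (x := z₀))
  have hmap := hder.map_nhds_eq_of_surj (by
    rw [LinearMap.range_eq_top]
    intro y
    refine ⟨((1 / 4 : ℝ) • ((y + yᵀ) * u⁻¹), (1 / 2 : ℝ) • y), ?_⟩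
    have h1 : (y + yᵀ) * u⁻¹ * u = y + yᵀ := by
      rw [Matrix.mul_assoc, Matrix.nonsing_inv_mul _ hu, Matrix.mul_one]
    have h2 : u * ((y + yᵀ) * u⁻¹)ᵀ = y + yᵀ := by
      have : ((y + yᵀ) * u⁻¹)ᵀ = u⁻¹ * (y + yᵀ) := by
        rw [Matrix.transpose_mul, Matrix.transpose_nonsing_inv, hsymm.eq]
        simp [add_comm]
      rw [this, ← Matrix.mul_assoc, Matrix.mul_nonsing_inv _ hu, Matrix.one_mul]
    change (1 * u) * ((1 / 4 : ℝ) • ((y + yᵀ) * u⁻¹))ᵀ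
      + ((1 / 4 : ℝ) • ((y + yᵀ) * u⁻¹)) * u * 1ᵀ
      + ((1 / 2 : ℝ) • y - ((1 / 2 : ℝ) • y)ᵀ) = y
    rw [Matrix.one_mul, transpose_smul, Matrix.mul_smul, h2, Matrix.smul_mul, h1, transpose_one,
      Matrix.mul_one]
    ext i j
    simp
    ring)
  have hval : (Mu ∘L Fst) z₀ * (T ∘L Fst) z₀ + (Snd - T ∘L Snd) z₀ = u := by
    change 1 * u * 1ᵀ + (0 - 0ᵀ) = u
    simp
  have hOE : {z : Matrix d d ℝ × Matrix d d ℝ | z.1 ∈ O} ∈ 𝓝 z₀ :=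
    (continuous_fst.tendsto z₀) hO
  have himg := image_mem_map (m := fun z : Matrix d d ℝ × Matrix d d ℝ =>
    (Mu ∘L Fst) z * (T ∘L Fst) z +
    (Snd - T ∘L Snd) z) hOE
  have h3 : (fun z : Matrix d d ℝ × Matrix d d ℝ => (Mu ∘L Fst) z * (T ∘L Fst) z +
    (Snd - T ∘L Snd) z) '' {z | z.1 ∈ O} ∈ 𝓝 u := by
    rw [← hval]
    exact hmap ▸ himg
  filter_upwards [h3] with w hw hws
  obtain ⟨⟨m, k⟩, hm, hmk⟩ := hw
  refine ⟨m, hm, ?_⟩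
  have hmk' : m * u * mᵀ + (k - kᵀ) = w := hmk
  have htr := congrArg transpose hmk'
  rw [hws.eq] at htr
  simp only [transpose_add, transpose_mul, transpose_sub, transpose_transpose, hsymm.eq,
    ← Matrix.mul_assoc] at htr
  have : k - kᵀ = 0 := by
    have h5 : m * u * mᵀ + (k - kᵀ) = m * u * mᵀ + (kᵀ - k) := hmk'.trans htr.symm
    have h6 := add_left_cancel h5
    ext i j
    have := congrFun (congrFun h6 i) j
    simp at this ⊢
    linarith
  rw [← hmk', this, add_zero]

/-! ### Perturbation of a single block -/

section Block

variable {Q : Type*} [Fintype Q]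

/-- `U` is a nonempty sum of matrices `a aᵀ` with entrywise positive vectors `a` from the kernel of
`A₀`, and these vectors span the kernel (expressed by `ker A₀ ∩ ker U = 0`). This is the form that
strict complementarity takes on a single block. -/
def HasPositiveFactorization (A₀ U : Matrix Q Q ℝ) : Prop :=
  ∃ (N : ℕ) (a : Fin (N + 1) → Q → ℝ), (∀ l k, 0 < a l k) ∧ (∀ l, A₀ *ᵥ a l = 0) ∧
    U = ∑ l, vecMulVec (a l) (a l) ∧ ∀ x, A₀ *ᵥ x = 0 → U *ᵥ x = 0 → x = 0

theorem mul_vecMulVec_mul_transpose {R : Type*} (G : Matrix R Q ℝ) (x : Q → ℝ) :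
    G * vecMulVec x x * Gᵀ = vecMulVec (G *ᵥ x) (G *ᵥ x) := by
  rw [mul_vecMulVec, vecMulVec_mul, vecMul_transpose]

theorem posSemidef_sum_vecMulVec {ι : Type*} (s : Finset ι) (a : ι → Q → ℝ) :
    (∑ i ∈ s, vecMulVec (a i) (a i)).PosSemidef :=
  posSemidef_sum s fun i _ => by simpa using posSemidef_vecMulVec_self_star (a i)

theorem HasPositiveFactorization.posSemidef {A₀ U : Matrix Q Q ℝ}
    (h : HasPositiveFactorization A₀ U) : U.PosSemidef := by
  obtain ⟨N, a, -, -, rfl, -⟩ := h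
  exact posSemidef_sum_vecMulVec _ a

/-- A sum of two positive semidefinite matrices with trivially intersecting kernels is positive
definite. -/
theorem dotProduct_add_mulVec_pos {A B : Matrix Q Q ℝ} (hA : A.PosSemidef) (hB : B.PosSemidef)
    (h : ∀ x, A *ᵥ x = 0 → B *ᵥ x = 0 → x = 0) (x : Q → ℝ) (hx : x ≠ 0) :
    0 < x ⬝ᵥ ((A + B) *ᵥ x) := by
  have hA' := (posSemidef_iff_real.1 hA).2 x
  have hB' := (posSemidef_iff_real.1 hB).2 x
  rw [add_mulVec, dotProduct_add]
  rcases hA'.lt_or_eq with h1 | h1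
  · linarith
  rcases hB'.lt_or_eq with h2 | h2
  · linarith
  exact absurd (h x (mulVec_eq_zero_of_posSemidef hA h1.symm)
    (mulVec_eq_zero_of_posSemidef hB h2.symm)) hx

/-- A symmetric `W` near `U` splits as a positive factorization near the one of `U`, plus a
remainder `R` that is annihilated by a fixed matrix `L` which is injective on `ker A₀`.

With `Z` a basis of `ker A₀`, `L Z = 1` and `w = L W Lᵀ`, the remainder is the Schur complement
`W - W Lᵀ w⁻¹ L W`, and the other part `(W Lᵀ w⁻¹) w (W Lᵀ w⁻¹)ᵀ` is a perturbation of `Z u Zᵀ = U`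
with `u = L U Lᵀ`. -/
theorem HasPositiveFactorization.eventually_split [DecidableEq Q] {A₀ U : Matrix Q Q ℝ}
    (h : HasPositiveFactorization A₀ U) :
    ∃ (N d : ℕ) (L : Matrix (Fin d) Q ℝ), (∀ x, A₀ *ᵥ x = 0 → L *ᵥ x = 0 → x = 0) ∧
      ∀ᶠ W in 𝓝 U, W.IsSymm → ∃ (a : Fin (N + 1) → Q → ℝ) (R : Matrix Q Q ℝ),
        (∀ l k, 0 < a l k) ∧ W = ∑ l, vecMulVec (a l) (a l) + R ∧ L * R = 0 ∧
        (W.PosSemidef → R.PosSemidef) ∧ ∀ A : Matrix Q Q ℝ, A * W = 0 → A * R = 0 := by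
  obtain ⟨N, a, hpos, hker, hU, hinj⟩ := h
  obtain ⟨d, Z, L, hAZ, hLZ, hZL⟩ := exists_kernelMatrix A₀
  refine ⟨N, d, L, fun x h1 h2 => by rw [← hZL x h1, h2, mulVec_zero], ?_⟩
  set u : Matrix (Fin d) (Fin d) ℝ := L * U * Lᵀ with hu
  have husum : u = ∑ l, vecMulVec (L *ᵥ a l) (L *ᵥ a l) := by
    rw [hu, hU, Matrix.mul_sum, Matrix.sum_mul]
    exact Finset.sum_congr rfl fun l _ => mul_vecMulVec_mul_transpose L (a l)
  have hUZ : U = Z * u * Zᵀ := by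
    rw [husum, Matrix.mul_sum, Matrix.sum_mul, hU]
    refine Finset.sum_congr rfl fun l _ => ?_
    rw [mul_vecMulVec_mul_transpose, hZL _ (hker l)]
  have hLZT : Zᵀ * Lᵀ = 1 := by rw [← transpose_mul, hLZ, transpose_one]
  -- `u` is nonsingular because the vectors `a l` span `ker A₀`.
  have hunit : IsUnit u.det := by
    have : IsUnit (u * (Zᵀ * Z)) := by
      rw [← mulVec_injective_iff_isUnit]
      refine (injective_iff_map_eq_zero (u * (Zᵀ * Z)).mulVecLin).2 fun c hc => ?_
      have hc' : (u * (Zᵀ * Z)) *ᵥ c = 0 := hc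
      have h1 : Z *ᵥ c = 0 := by
        refine hinj _ (by rw [mulVec_mulVec, hAZ, zero_mulVec]) ?_
        rw [hUZ, mulVec_mulVec, Matrix.mul_assoc, Matrix.mul_assoc, ← mulVec_mulVec, hc',
          mulVec_zero]
      rw [← one_mulVec c, ← hLZ, ← mulVec_mulVec, h1, mulVec_zero]
    rw [isUnit_iff_isUnit_det, det_mul] at this
    exact isUnit_of_mul_isUnit_left this
  have husymm : u.IsSymm := by
    rw [husum]
    exact (posSemidef_iff_real.1 (posSemidef_sum_vecMulVec _ _)).1
  have hcw : Continuous fun W : Matrix Q Q ℝ => L * W * Lᵀ := by fun_prop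
  have hcinv : ContinuousAt (fun W : Matrix Q Q ℝ => (L * W * Lᵀ)⁻¹) U := by
    have h1 : ContinuousAt (Inv.inv : Matrix (Fin d) (Fin d) ℝ → _) u := by
      refine continuousAt_matrix_inv u ?_
      rw [Ring.inverse_eq_inv']
      exact continuousAt_inv₀ hunit.ne_zero
    exact ContinuousAt.comp (f := fun W : Matrix Q Q ℝ => L * W * Lᵀ) h1 hcw.continuousAt
  have hcont : ContinuousAt (fun z : Matrix Q Q ℝ × Matrix (Fin d) (Fin d) ℝ =>
      z.1 * Lᵀ * (L * z.1 * Lᵀ)⁻¹ * z.2) (U, 1) := by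
    have h1 : ContinuousAt (fun z : Matrix Q Q ℝ × Matrix (Fin d) (Fin d) ℝ =>
        (L * z.1 * Lᵀ)⁻¹) (U, 1) :=
      ContinuousAt.comp (f := Prod.fst) (x := (U, (1 : Matrix (Fin d) (Fin d) ℝ))) hcinv
        continuousAt_fst
    have h2 : ContinuousAt (fun z : Matrix Q Q ℝ × Matrix (Fin d) (Fin d) ℝ =>
        z.1 * Lᵀ) (U, 1) := by fun_prop
    have hmul : Continuous fun z : Matrix Q (Fin d) ℝ × Matrix (Fin d) (Fin d) ℝ =>
        z.1 * z.2 := by fun_prop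
    exact hmul.continuousAt.comp ((hmul.continuousAt.comp (h2.prodMk h1)).prodMk continuousAt_snd)
  have hval : ∀ l,
      (U * Lᵀ * (L * U * Lᵀ)⁻¹ * (1 : Matrix (Fin d) (Fin d) ℝ)) *ᵥ (L *ᵥ a l) = a l := by
    intro l
    have : U * Lᵀ * u⁻¹ * (1 : Matrix (Fin d) (Fin d) ℝ) = Z := by
      rw [Matrix.mul_one, hUZ, Matrix.mul_assoc _ Zᵀ, hLZT, Matrix.mul_one, Matrix.mul_assoc,
        mul_nonsing_inv _ hunit, Matrix.mul_one]
    rw [← hu, this, hZL _ (hker l)]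
  have hev : ∀ᶠ z : Matrix Q Q ℝ × Matrix (Fin d) (Fin d) ℝ in 𝓝 U ×ˢ 𝓝 1,
      ∀ l k, 0 < ((z.1 * Lᵀ * (L * z.1 * Lᵀ)⁻¹ * z.2) *ᵥ (L *ᵥ a l)) k := by
    rw [← nhds_prod_eq, eventually_all]
    intro l
    rw [eventually_all]
    intro k
    have hc : Continuous fun M : Matrix Q (Fin d) ℝ => (M *ᵥ (L *ᵥ a l)) k := by fun_prop
    have h1 := (hc.continuousAt.comp hcont).eventually (lt_mem_nhds (a := 0) (by
      simp only [Function.comp_apply, hval]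
      exact hpos l k))
    exact h1
  obtain ⟨pa, hpa, pb, hpb, hpab⟩ := eventually_prod_iff.1 hev
  have hcong := (hcw.tendsto U).eventually (eventually_exists_congruence hunit husymm hpb)
  have hdet : ∀ᶠ W in 𝓝 U, IsUnit (L * W * Lᵀ).det := by
    have := (hcw.matrix_det.tendsto U).eventually_ne hunit.ne_zero
    exact this.mono fun W hW => hW.isUnit
  filter_upwards [hpa, hcong, hdet] with W hWpa hWcong hWdet hW
  have hwsymm : (L * W * Lᵀ).IsSymm := by
    change (L * W * Lᵀ)ᵀ = _
    rw [transpose_mul, transpose_mul, hW.eq, transpose_transpose, Matrix.mul_assoc]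
  obtain ⟨m, hm, hmw⟩ := hWcong hwsymm
  set w := L * W * Lᵀ with hw
  set G := W * Lᵀ * w⁻¹ with hG
  have hGT : Gᵀ = w⁻¹ * L * W := by
    rw [hG, transpose_mul, transpose_mul, transpose_transpose, hW.eq, transpose_nonsing_inv,
      hwsymm.eq, Matrix.mul_assoc]
  have hT : G * w * Gᵀ = G * L * W := by
    rw [hGT, ← Matrix.mul_assoc, ← Matrix.mul_assoc, Matrix.mul_assoc G,
      mul_nonsing_inv _ hWdet, Matrix.mul_one]
  have hT2 : W * (Lᵀ * Gᵀ) = G * L * W := by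
    rw [hGT, hG]
    simp only [Matrix.mul_assoc]
  refine ⟨fun l => (G * m) *ᵥ (L *ᵥ a l), W - G * L * W, fun l k => hpab hWpa hm l k, ?_, ?_, ?_,
    ?_⟩
  · have : ∑ l, vecMulVec ((G * m) *ᵥ (L *ᵥ a l)) ((G * m) *ᵥ (L *ᵥ a l)) = G * w * Gᵀ := by
      rw [← hmw, husum]
      simp only [← mul_vecMulVec_mul_transpose (G * m), ← Matrix.sum_mul, ← Matrix.mul_sum,
        transpose_mul, Matrix.mul_assoc]
    rw [this, hT]
    abel
  · have : L * G = 1 := by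
      rw [hG, ← Matrix.mul_assoc, ← Matrix.mul_assoc, ← hw, mul_nonsing_inv _ hWdet]
    rw [Matrix.mul_sub, Matrix.mul_assoc, ← Matrix.mul_assoc L G, this, Matrix.one_mul, sub_self]
  · intro hWP
    have h1 := hWP.mul_mul_conjTranspose_same (1 - G * L)
    have h2 : (1 - G * L) * W * (1 - G * L)ᴴ = W - G * L * W := by
      rw [conjTranspose_eq_transpose_of_trivial, transpose_sub, transpose_one, transpose_mul,
        Matrix.mul_sub, Matrix.mul_one, Matrix.sub_mul, Matrix.one_mul, Matrix.sub_mul, hT2]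
      have h3 : G * L * W * (Lᵀ * Gᵀ) = G * L * W := by
        conv_rhs => rw [← hT, hw]
        simp only [Matrix.mul_assoc]
      rw [h3]
      abel
    rwa [h2] at h1
  · intro A hA
    rw [Matrix.mul_sub, hA, hG, ← Matrix.mul_assoc, ← Matrix.mul_assoc, ← Matrix.mul_assoc,
      ← Matrix.mul_assoc, hA]
    simp

theorem posSemidef_transpose_mul_self {d : Type*} [Fintype d] (L : Matrix d Q ℝ) :
    (Lᵀ * L).PosSemidef := by
  simpa using posSemidef_conjTranspose_mul_self L

theorem eventually_add_transpose_mul_self_pos {d : Type*} [Fintype d] {A₀ : Matrix Q Q ℝ}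
    (hA₀ : A₀.PosSemidef) {L : Matrix d Q ℝ} (hL : ∀ x, A₀ *ᵥ x = 0 → L *ᵥ x = 0 → x = 0) :
    ∀ᶠ A in 𝓝 A₀, ∀ x, x ≠ 0 → 0 < x ⬝ᵥ ((A + Lᵀ * L) *ᵥ x) := by
  have h1 := dotProduct_add_mulVec_pos hA₀ (posSemidef_transpose_mul_self L) (fun x hx hLx => by
    refine hL x hx ?_
    rw [← dotProduct_self_eq_zero, dotProduct_mulVec, ← mulVec_transpose, mulVec_mulVec, hLx,
      zero_dotProduct])
  have hc : Continuous fun A : Matrix Q Q ℝ => A + Lᵀ * L := by fun_prop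
  exact (hc.tendsto A₀).eventually (eventually_forall_pos h1)

/-- Near `(A₀, U)`, the Lyapunov equation forces `A` to be positive semidefinite and `W` to be a
nonempty sum of matrices `a aᵀ` with positive vectors `a`. -/
theorem HasPositiveFactorization.eventually_of_lyapunov [DecidableEq Q] {A₀ U : Matrix Q Q ℝ}
    (hA₀ : A₀.PosSemidef) (h : HasPositiveFactorization A₀ U) :
    ∀ᶠ z : Matrix Q Q ℝ × Matrix Q Q ℝ in 𝓝 (A₀, U), z.1.IsSymm → z.2.IsSymm →
      z.1 * z.2 + z.2 * z.1 = 0 → z.1.PosSemidef ∧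
        ∃ (N : ℕ) (a : Fin (N + 1) → Q → ℝ), (∀ l k, 0 < a l k) ∧
          z.2 = ∑ l, vecMulVec (a l) (a l) := by
  obtain ⟨N, d, L, hL, hsplit⟩ := h.eventually_split
  have hpos : ∀ᶠ z : Matrix Q Q ℝ × Matrix Q Q ℝ in 𝓝 (A₀, U),
      ∀ x, x ≠ 0 → 0 < x ⬝ᵥ ((z.1 + z.2) *ᵥ x) := by
    have hc : Continuous fun z : Matrix Q Q ℝ × Matrix Q Q ℝ => z.1 + z.2 := by fun_prop
    refine (hc.tendsto (A₀, U)).eventually (eventually_forall_pos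
      (dotProduct_add_mulVec_pos hA₀ h.posSemidef ?_))
    obtain ⟨-, -, -, -, -, hinj⟩ := h
    exact hinj
  filter_upwards [hpos, continuousAt_snd.eventually hsplit,
    continuousAt_fst.eventually (eventually_add_transpose_mul_self_pos hA₀ hL)]
    with ⟨A, W⟩ hAW hWs hAL hA hW hlyap
  simp only at *
  have hAH : A.IsHermitian := by simpa [IsHermitian, IsSymm] using hA
  have hPSD : A.PosSemidef := by
    refine hAH.posSemidef_iff_eigenvalues_nonneg.2 fun i => ?_
    set q : Q → ℝ := (hAH.eigenvectorBasis i).ofLp with hq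
    set c := hAH.eigenvalues i with hc
    have hAq : A *ᵥ q = c • q := hAH.mulVec_eigenvectorBasis i
    have hq0 : q ≠ 0 := by
      intro h0
      have := hAH.eigenvectorBasis.toBasis.ne_zero i
      apply this
      ext k
      simpa using congrFun h0 k
    -- For `c < 0` the Lyapunov equation gives `q ⬝ᵥ W q = 0`, against `A + W` positive definite.
    by_contra! hneg
    have hneg : c < 0 := hneg
    have h1 : q ⬝ᵥ ((A * W + W * A) *ᵥ q) = 0 := by rw [hlyap, zero_mulVec, dotProduct_zero]
    rw [add_mulVec, ← mulVec_mulVec, ← mulVec_mulVec, hAq, dotProduct_add,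
      dotProduct_mulVec_symm hA, hAq, mulVec_smul] at h1
    simp only [dotProduct_smul, smul_eq_mul] at h1
    have h2 : q ⬝ᵥ (W *ᵥ q) = 0 := by
      have : c * (q ⬝ᵥ (W *ᵥ q)) = 0 := by
        rw [dotProduct_comm (W *ᵥ q)] at h1
        linarith
      exact (mul_eq_zero.1 this).resolve_left hneg.ne
    have h3 := hAW q hq0
    rw [add_mulVec, dotProduct_add, h2, hAq, dotProduct_smul, smul_eq_mul, add_zero] at h3
    have h4 : 0 ≤ q ⬝ᵥ q := Finset.sum_nonneg fun k _ => mul_self_nonneg _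
    nlinarith
  have hAW0 := mul_eq_zero_of_lyapunov hPSD hW hlyap
  obtain ⟨a, R, ha, hWa, hLR, -, hAR⟩ := hWs hW
  -- `R` is annihilated by `A` and by `L`, hence by the positive definite `A + Lᵀ L`.
  have hR : R = 0 := by
    have h1 : (A + Lᵀ * L) * R = 0 := by
      rw [Matrix.add_mul, hAR A hAW0, Matrix.mul_assoc, hLR, Matrix.mul_zero, add_zero]
    refine Matrix.ext_of_mulVec_single fun j => ?_
    rw [zero_mulVec]
    by_contra hne
    have := hAL _ hne
    rw [mulVec_mulVec, h1, zero_mulVec, dotProduct_zero] at this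
    exact lt_irrefl _ this
  exact ⟨hPSD, N, a, ha, by rw [hWa, hR, add_zero]⟩

/-- Near `(A₀, U)`, if `A` is copositive, `W` is positive semidefinite and `A • W = 0`, then
`A W = 0`. -/
theorem HasPositiveFactorization.eventually_mul_eq_zero [DecidableEq Q] {A₀ U : Matrix Q Q ℝ}
    (hA₀ : A₀.PosSemidef) (h : HasPositiveFactorization A₀ U) :
    ∀ᶠ z : Matrix Q Q ℝ × Matrix Q Q ℝ in 𝓝 (A₀, U), z.1.IsSymm →
      (∀ x, 0 ≤ x → 0 ≤ x ⬝ᵥ (z.1 *ᵥ x)) → z.2.PosSemidef → (z.1 * z.2).trace = 0 →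
        z.1 * z.2 = 0 := by
  obtain ⟨N, d, L, hL, hsplit⟩ := h.eventually_split
  filter_upwards [continuousAt_snd.eventually hsplit,
    continuousAt_fst.eventually (eventually_add_transpose_mul_self_pos hA₀ hL)]
    with ⟨A, W⟩ hWs hAL hA hcop hW htr
  simp only at *
  obtain ⟨a, R, ha, hWa, hLR, hRP, -⟩ := hWs (posSemidef_iff_real.1 hW).1
  have hALP : (A + Lᵀ * L).PosSemidef := by
    refine posSemidef_iff_real.2 ⟨hA.add (posSemidef_iff_real.1
      (posSemidef_transpose_mul_self L)).1, fun x => ?_⟩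
    by_cases hx : x = 0
    · simp [hx]
    · exact (hAL x hx).le
  -- `A` need not be positive semidefinite yet, but `A` and `A + Lᵀ L` agree on `R` as `L R = 0`.
  have hAR : 0 ≤ (A * R).trace := by
    have h1 := trace_mul_nonneg_of_posSemidef hALP (hRP hW)
    rwa [Matrix.add_mul, Matrix.mul_assoc, hLR, Matrix.mul_zero, add_zero] at h1
  have hnn : ∀ l ∈ Finset.univ, 0 ≤ a l ⬝ᵥ (A *ᵥ a l) := fun l _ =>
    hcop _ fun k => (ha l k).le
  have hsum : ∑ l, a l ⬝ᵥ (A *ᵥ a l) + (A * R).trace = 0 := by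
    rw [← htr]
    conv_rhs => rw [hWa]
    rw [Matrix.mul_add, Matrix.mul_sum, trace_add, trace_sum]
    simp only [trace_mul_vecMulVec_self]
  have h0 : ∑ l, a l ⬝ᵥ (A *ᵥ a l) = 0 := by
    have := Finset.sum_nonneg hnn
    linarith
  have hz := (Finset.sum_eq_zero_iff_of_nonneg hnn).1 h0 0 (Finset.mem_univ _)
  exact mul_eq_zero_of_trace_eq_zero (posSemidef_of_pos_zero hA hcop (ha 0) hz) hW htr

end Block

/-! ### Zeros of a copositive quadratic form -/

/-- In a finite-dimensional space the convex hull of a compact set is compact, by Carathéodory's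
theorem. -/
theorem isCompact_convexHull_of_isCompact {p : ℕ} {s : Set (Fin p → ℝ)} (hs : IsCompact s) :
    IsCompact (convexHull ℝ s) := by
  let N := Module.finrank ℝ (Fin p → ℝ) + 1
  have hK : IsCompact (stdSimplex ℝ (Fin N) ×ˢ
      (Set.univ.pi fun _ : Fin N => s)) :=
    (isCompact_stdSimplex ℝ (Fin N)).prod (isCompact_univ_pi fun _ => hs)
  have hf : Continuous fun q : (Fin N → ℝ) × (Fin N → Fin p → ℝ) => ∑ i, q.1 i • q.2 i := by
    fun_prop
  convert hK.image hf using 1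
  apply Set.Subset.antisymm
  · intro x hx
    obtain ⟨ι, _, z, w, hz, hai, hw, hw1, hx⟩ := eq_pos_convex_span_of_mem_convexHull hx
    have hcard : Fintype.card ι ≤ Fintype.card (Fin N) := by
      rw [Fintype.card_fin]
      exact hai.card_le_finrank_succ.trans (Nat.add_le_add_right (Submodule.finrank_le _) 1)
    obtain ⟨e⟩ := Function.Embedding.nonempty_of_card_le hcard
    have hne : Nonempty ι := by
      by_contra hcon
      rw [not_nonempty_iff] at hcon
      simp at hw1
    obtain ⟨i₀⟩ := hne
    refine ⟨(Function.extend e w 0, Function.extend e z fun _ => z i₀), ⟨⟨?_, ?_⟩, ?_⟩, ?_⟩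
    · intro k
      by_cases hk : ∃ i, e i = k
      · obtain ⟨i, rfl⟩ := hk
        simpa [e.injective.extend_apply] using (hw i).le
      · simp [Function.extend_apply' _ _ _ hk]
    · rw [← hw1]
      refine (Fintype.sum_of_injective e e.injective _ _ ?_ ?_).symm
      · intro k hk
        exact Function.extend_apply' _ _ _ hk
      · intro i
        exact (e.injective.extend_apply _ _ i).symm
    · intro k _
      by_cases hk : ∃ i, e i = k
      · obtain ⟨i, rfl⟩ := hk
        simpa [e.injective.extend_apply] using hz ⟨i, rfl⟩
      · simpa [Function.extend_apply' _ _ _ hk] using hz ⟨i₀, rfl⟩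
    · rw [← hx]
      refine (Fintype.sum_of_injective e e.injective _ _ ?_ ?_).symm
      · intro k hk
        simp [Function.extend_apply' w (0 : Fin N → ℝ) k hk]
      · intro i
        simp [e.injective.extend_apply]
  · rintro _ ⟨⟨w, z⟩, ⟨hw, hz⟩, rfl⟩
    exact (convex_convexHull ℝ s).sum_mem (fun i _ => hw.1 i) hw.2
      fun i _ => subset_convexHull ℝ s (hz i trivial)

section Zeros

variable {p n m : ℕ} {X : Matrix (Fin p) (Fin p) ℝ}

theorem sum_pos_of_ne_zero {t : Fin p → ℝ} (ht : 0 ≤ t) (hne : t ≠ 0) : 0 < ∑ k, t k := by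
  obtain ⟨k, hk⟩ := Function.ne_iff.1 hne
  exact Finset.sum_pos' (fun k _ => ht k) ⟨k, Finset.mem_univ k, lt_of_le_of_ne (ht k) (Ne.symm hk)⟩

theorem inv_sum_smul_mem_normalizedZeros {t : Fin p → ℝ} (ht : 0 ≤ t) (hne : t ≠ 0)
    (h0 : t ⬝ᵥ (X *ᵥ t) = 0) : (∑ k, t k)⁻¹ • t ∈ normalizedZeros X := by
  have hs := sum_pos_of_ne_zero ht hne
  have hnn : 0 ≤ (∑ k, t k)⁻¹ • t := smul_nonneg (inv_nonneg.2 hs.le) ht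
  refine ⟨hnn, ?_, ?_⟩
  · rw [Finset.sum_congr rfl fun k _ => abs_of_nonneg (hnn k)]
    simp only [Pi.smul_apply, smul_eq_mul, ← Finset.mul_sum]
    exact inv_mul_cancel₀ hs.ne'
  · rw [mulVec_smul, dotProduct_smul, smul_dotProduct, h0, smul_zero, smul_zero]

theorem mulVec_nonneg_of_quadratic_zero (hX : X ∈ cop p) {t : Fin p → ℝ} (ht : 0 ≤ t)
    (h0 : t ⬝ᵥ (X *ᵥ t) = 0) (k : Fin p) : 0 ≤ (X *ᵥ t) k := by
  by_cases hne : t = 0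
  · simp [hne]
  have := mulVec_nonneg_of_zero hX (inv_sum_smul_mem_normalizedZeros ht hne h0) k
  rw [mulVec_smul, Pi.smul_apply, smul_eq_mul] at this
  exact nonneg_of_mul_nonneg_right this (inv_pos.2 (sum_pos_of_ne_zero ht hne))

theorem mul_mulVec_eq_zero (hX : X ∈ cop p) {t : Fin p → ℝ} (ht : 0 ≤ t)
    (h0 : t ⬝ᵥ (X *ᵥ t) = 0) (k : Fin p) : t k * (X *ᵥ t) k = 0 :=
  (Finset.sum_eq_zero_iff_of_nonneg (fun k _ =>
    mul_nonneg (ht k) (mulVec_nonneg_of_quadratic_zero hX ht h0 k))).1 h0 k (Finset.mem_univ k)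

theorem normalizedZeros_subset_convexHull {τ : Fin n → Fin p → ℝ}
    (hτ : IsVertexList X τ) : normalizedZeros X ⊆ convexHull ℝ (Set.range τ) := by
  have hcomp : IsCompact (normalizedZeros X) := by
    refine IsCompact.of_isClosed_subset (isCompact_univ_pi fun _ : Fin p =>
      isCompact_Icc (a := (0 : ℝ)) (b := 1)) ?_ ?_
    · refine (isClosed_le continuous_const continuous_id).inter (IsClosed.inter ?_ ?_)
      · exact isClosed_eq (by fun_prop) continuous_const
      · exact isClosed_eq (by fun_prop) continuous_const
    · rintro t ⟨h0, h1, -⟩ k -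
      refine ⟨h0 k, ?_⟩
      rw [← h1]
      exact (le_abs_self _).trans
        (Finset.single_le_sum (f := fun k => |t k|) (fun _ _ => abs_nonneg _) (Finset.mem_univ k))
  have h1 := closure_convexHull_extremePoints (isCompact_convexHull_of_isCompact hcomp)
    (convex_convexHull ℝ _)
  have h2 : (convexHull ℝ (normalizedZeros X)).extremePoints ℝ = Set.range τ := hτ.2.symm
  rw [h2, (Set.finite_range τ).isClosed_convexHull ℝ |>.closure_eq] at h1
  rw [h1]
  exact subset_convexHull ℝ _

variable {τ : Fin n → Fin p → ℝ} {J : Fin m → Finset (Fin n)}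

theorem IsVertexList.mem_normalizedZeros (hτ : IsVertexList X τ) (j : Fin n) :
    τ j ∈ normalizedZeros X :=
  extremePoints_convexHull_subset (hτ.2 ▸ Set.mem_range_self j)

theorem mem_indexM {j : Fin n} {k : Fin p} : k ∈ indexM X τ j ↔ (X *ᵥ τ j) k = 0 := by
  simp [indexM]

theorem mem_supp {t : Fin p → ℝ} {k : Fin p} : k ∈ supp t ↔ t k ≠ 0 := by
  simp [supp]

/-- The index sets of the cover are maximal cliques: a vertex orthogonal (with respect to `X`) to
all vertices of `J s` belongs to `J s`. -/
theorem IsZeroCover.mem_of_supp_subset (hJ : IsZeroCover X τ J) {s : Fin m} {j : Fin n}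
    (h : ∀ i ∈ J s, supp (τ j) ⊆ indexM X τ i) : j ∈ J s := by
  by_contra hj
  obtain ⟨r, hr⟩ := hJ.cover j
  have hrs : r ≠ s := by
    rintro rfl
    exact hj hr
  obtain ⟨i, hi, k, hk, hk'⟩ := (hJ.separated r s hrs).2.2 j (Finset.mem_sdiff.2 ⟨hr, hj⟩)
  exact hk' (h i (Finset.mem_sdiff.1 hi).1 hk)

/-- Every nonzero zero `t` of the quadratic form lies in the cone over the vertices of one block
`s`, and `X t` vanishes exactly on the index set of this block. -/
theorem exists_block_of_zero (hX : X ∈ cop p) (hτ : IsVertexList X τ) (hJ : IsZeroCover X τ J)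
    (h3 : ∀ s, ∀ j ∈ J s, indexM X τ j = indexP τ (J s)) {t : Fin p → ℝ} (ht : 0 ≤ t)
    (hne : t ≠ 0) (h0 : t ⬝ᵥ (X *ᵥ t) = 0) :
    ∃ s, (∀ k, (X *ᵥ t) k = 0 ↔ k ∈ indexP τ (J s)) ∧
      t ∈ Submodule.span ℝ (τ '' (J s : Set (Fin n))) := by
  have hs := sum_pos_of_ne_zero ht hne
  have htn := inv_sum_smul_mem_normalizedZeros ht hne h0
  obtain ⟨ι, _, w, z, hw, hw1, hz, hwz⟩ :=
    mem_convexHull_iff_exists_fintype.1 (normalizedZeros_subset_convexHull hτ htn)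
  choose g hg using hz
  obtain rfl : z = fun i => τ (g i) := funext fun i => (hg i).symm
  have hz := fun j => hτ.mem_normalizedZeros j
  have hnn : ∀ i j, 0 ≤ τ i ⬝ᵥ (X *ᵥ τ j) := fun i j =>
    Finset.sum_nonneg fun k _ => mul_nonneg ((hz i).1 k) (mulVec_nonneg_of_zero hX (hz j) k)
  have hquad : ∑ i, ∑ j, w i * (w j * (τ (g i) ⬝ᵥ (X *ᵥ τ (g j)))) = 0 := by
    have := htn.2.2
    rw [← hwz] at this
    rw [← this, sum_dotProduct]
    refine Finset.sum_congr rfl fun i _ => ?_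
    rw [smul_dotProduct, mulVec_sum, dotProduct_sum, smul_eq_mul, Finset.mul_sum]
    refine Finset.sum_congr rfl fun j _ => ?_
    rw [mulVec_smul, dotProduct_smul, smul_eq_mul]
  have hterm : ∀ i j, w i * (w j * (τ (g i) ⬝ᵥ (X *ᵥ τ (g j)))) = 0 := by
    have hnn' : ∀ i j, 0 ≤ w i * (w j * (τ (g i) ⬝ᵥ (X *ᵥ τ (g j)))) := fun i j =>
      mul_nonneg (hw i) (mul_nonneg (hw j) (hnn _ _))
    intro i j
    have h1 := (Finset.sum_eq_zero_iff_of_nonneg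
      (fun i _ => Finset.sum_nonneg fun j _ => hnn' i j)).1 hquad i (Finset.mem_univ i)
    exact (Finset.sum_eq_zero_iff_of_nonneg (fun j _ => hnn' i j)).1 h1 j (Finset.mem_univ j)
  obtain ⟨i₀, hi₀⟩ : ∃ i, w i ≠ 0 := by
    by_contra! hcon
    simp [hcon] at hw1
  obtain ⟨s, hsJ⟩ := hJ.cover (g i₀)
  -- The quadratic form has nonnegative terms, so all vertices in the combination are orthogonal
  -- to `τ (g i₀)`; since `indexM` is constant on `J s`, they are orthogonal to all of `J s`.
  have hmem : ∀ j, w j ≠ 0 → g j ∈ J s := by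
    intro j hj
    refine hJ.mem_of_supp_subset fun i hi => ?_
    rw [h3 s i hi, ← h3 s _ hsJ]
    intro k hk
    have h1 : τ (g j) ⬝ᵥ (X *ᵥ τ (g i₀)) = 0 := by
      have := hterm j i₀
      simpa [hj, hi₀] using this
    have h2 := (Finset.sum_eq_zero_iff_of_nonneg (fun k _ => mul_nonneg ((hz (g j)).1 k)
      (mulVec_nonneg_of_zero hX (hz (g i₀)) k))).1 h1 k (Finset.mem_univ k)
    exact mem_indexM.2 ((mul_eq_zero.1 h2).resolve_left (mem_supp.1 hk))
  have htτ : t = (∑ k, t k) • ∑ i, w i • τ (g i) := by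
    rw [hwz, smul_smul, mul_inv_cancel₀ hs.ne', one_smul]
  refine ⟨s, fun k => ?_, ?_⟩
  · have hXt : (X *ᵥ t) k = (∑ k, t k) * ∑ i, w i * (X *ᵥ τ (g i)) k := by
      conv_lhs => rw [htτ]
      rw [mulVec_smul, mulVec_sum]
      simp [mulVec_smul]
    rw [hXt, mul_eq_zero, or_iff_right hs.ne', Finset.sum_eq_zero_iff_of_nonneg fun i _ =>
      mul_nonneg (hw i) (mulVec_nonneg_of_zero hX (hz _) k)]
    constructor
    · intro h
      rw [← h3 s _ hsJ, mem_indexM]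
      exact (mul_eq_zero.1 (h i₀ (Finset.mem_univ _))).resolve_left hi₀
    · intro hk i _
      by_cases hi : w i = 0
      · rw [hi, zero_mul]
      · rw [← h3 s _ (hmem i hi), mem_indexM] at hk
        rw [hk, mul_zero]
  · rw [htτ]
    refine Submodule.smul_mem _ _ (Submodule.sum_mem _ fun i _ => ?_)
    by_cases hi : w i = 0
    · rw [hi, zero_smul]
      exact Submodule.zero_mem _
    · exact Submodule.smul_mem _ _ (Submodule.subset_span ⟨g i, hmem i hi, rfl⟩)

end Zeros

/-! ### Padding by zeros -/

section ZeroPad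

variable {p : ℕ} {Q : Finset (Fin p)}

/-- Extension of a vector with index set `Q` by zeros. -/
def zeroExtend (x : Q → ℝ) : Fin p → ℝ := fun k => if h : k ∈ Q then x ⟨k, h⟩ else 0

/-- Restriction of a vector to the index set `Q`. -/
def restrictTo (Q : Finset (Fin p)) (t : Fin p → ℝ) : Q → ℝ := fun k => t k

theorem zeroExtend_coe (x : Q → ℝ) (k : Q) : zeroExtend x k = x k := by
  simp [zeroExtend]

theorem zeroExtend_of_notMem (x : Q → ℝ) {k : Fin p} (hk : k ∉ Q) : zeroExtend x k = 0 := by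
  simp [zeroExtend, hk]

theorem zeroExtend_restrictTo {t : Fin p → ℝ} (h : supp t ⊆ Q) :
    zeroExtend (restrictTo Q t) = t := by
  ext k
  by_cases hk : k ∈ Q
  · exact zeroExtend_coe _ ⟨k, hk⟩
  · rw [zeroExtend_of_notMem _ hk]
    by_contra hne
    exact hk (h (mem_supp.2 (Ne.symm hne)))

theorem zeroExtend_dotProduct (x : Q → ℝ) (v : Fin p → ℝ) :
    zeroExtend x ⬝ᵥ v = x ⬝ᵥ restrictTo Q v := by
  symm
  refine Fintype.sum_of_injective (Subtype.val : Q → Fin p) Subtype.val_injective _ _ ?_ ?_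
  · intro k hk
    rw [zeroExtend_of_notMem, zero_mul]
    simpa using hk
  · intro k
    rw [zeroExtend_coe]
    rfl

theorem principal_mulVec (X : Matrix (Fin p) (Fin p) ℝ) (x : Q → ℝ) :
    principal X Q *ᵥ x = restrictTo Q (X *ᵥ zeroExtend x) := by
  ext k
  change _ = X k ⬝ᵥ zeroExtend x
  rw [dotProduct_comm, zeroExtend_dotProduct, dotProduct_comm]
  rfl

theorem dotProduct_principal_mulVec (X : Matrix (Fin p) (Fin p) ℝ) (x : Q → ℝ) :
    x ⬝ᵥ (principal X Q *ᵥ x) = zeroExtend x ⬝ᵥ (X *ᵥ zeroExtend x) := by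
  rw [zeroExtend_dotProduct, principal_mulVec]

theorem isSymm_principal {X : Matrix (Fin p) (Fin p) ℝ} (hX : X.IsSymm) :
    (principal X Q).IsSymm := hX.submatrix _

theorem zeroExtend_nonneg {x : Q → ℝ} (hx : 0 ≤ x) : 0 ≤ zeroExtend x := by
  intro k
  by_cases hk : k ∈ Q
  · simpa [zeroExtend, hk] using hx ⟨k, hk⟩
  · simp [zeroExtend, hk]

theorem zeroExtend_add (x y : Q → ℝ) : zeroExtend (x + y) = zeroExtend x + zeroExtend y := by
  ext k
  by_cases hk : k ∈ Q <;> simp [zeroExtend, hk]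

theorem zeroExtend_smul (c : ℝ) (x : Q → ℝ) : zeroExtend (c • x) = c • zeroExtend x := by
  ext k
  by_cases hk : k ∈ Q <;> simp [zeroExtend, hk]

theorem zeroPad_add (V W : Matrix Q Q ℝ) : zeroPad (V + W) = zeroPad V + zeroPad W := by
  ext k q
  by_cases h : k ∈ Q ∧ q ∈ Q <;> simp [zeroPad, h]

theorem zeroPad_smul (c : ℝ) (W : Matrix Q Q ℝ) : zeroPad (c • W) = c • zeroPad W := by
  ext k q
  by_cases h : k ∈ Q ∧ q ∈ Q <;> simp [zeroPad, h]

theorem zeroPad_zero : zeroPad (0 : Matrix Q Q ℝ) = 0 := by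
  ext k q
  simp [zeroPad]

theorem zeroPad_sum {ι : Type*} (s : Finset ι) (W : ι → Matrix Q Q ℝ) :
    zeroPad (∑ i ∈ s, W i) = ∑ i ∈ s, zeroPad (W i) := by
  classical
  induction s using Finset.induction_on with
  | empty => simp [zeroPad_zero]
  | insert a s ha ih => rw [Finset.sum_insert ha, Finset.sum_insert ha, zeroPad_add, ih]

theorem zeroPad_injective : Function.Injective (zeroPad : Matrix Q Q ℝ → _) := by
  intro V W h
  ext k q
  have := congrFun (congrFun h k) q
  simpa [zeroPad] using this

theorem zeroPad_vecMulVec (x y : Q → ℝ) :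
    zeroPad (vecMulVec x y) = vecMulVec (zeroExtend x) (zeroExtend y) := by
  ext k q
  by_cases hk : k ∈ Q <;> by_cases hq : q ∈ Q <;> simp [zeroPad, zeroExtend, vecMulVec, hk, hq]

theorem continuous_zeroPad : Continuous (zeroPad : Matrix Q Q ℝ → _) := by
  refine continuous_matrix fun k q => ?_
  by_cases h : k ∈ Q ∧ q ∈ Q
  · simp only [zeroPad, of_apply, h, and_self, dif_pos]
    fun_prop
  · simp only [zeroPad, of_apply, h, dif_neg, not_false_eq_true]
    fun_prop

theorem ip_vecMulVec_right (X : Matrix (Fin p) (Fin p) ℝ) (t : Fin p → ℝ) :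
    ip X (vecMulVec t t) = t ⬝ᵥ (X *ᵥ t) := trace_mul_vecMulVec_self X t

theorem ip_sum_right {ι : Type*} (s : Finset ι) (X : Matrix (Fin p) (Fin p) ℝ)
    (V : ι → Matrix (Fin p) (Fin p) ℝ) : ip X (∑ i ∈ s, V i) = ∑ i ∈ s, ip X (V i) := by
  simp only [ip, Matrix.mul_sum, trace_sum]

theorem ip_zeroPad (X : Matrix (Fin p) (Fin p) ℝ) (W : Matrix Q Q ℝ) :
    ip X (zeroPad W) = (principal X Q * W).trace := by
  have h1 : ∀ i : Fin p, (X * zeroPad W) i i =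
      if h : i ∈ Q then ∑ j : Q, X i j * W j ⟨i, h⟩ else 0 := by
    intro i
    by_cases hi : i ∈ Q
    · simp only [hi, dif_pos]
      rw [mul_apply]
      symm
      refine Fintype.sum_of_injective (Subtype.val : Q → Fin p) Subtype.val_injective _ _ ?_ ?_
      · intro k hk
        have : k ∉ Q := by simpa using hk
        simp [zeroPad, this]
      · intro k
        simp [zeroPad, hi]
    · simp [mul_apply, zeroPad, hi]
  symm
  refine Fintype.sum_of_injective (Subtype.val : Q → Fin p) Subtype.val_injective _ _ ?_ ?_
  · intro k hk
    have : k ∉ Q := by simpa using hk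
    simp [h1, this]
  · intro k
    change (principal X Q * W) k k = (X * zeroPad W) k k
    rw [h1]
    simp [mul_apply, principal]

/-- A sum of rank-one matrices whose vectors are each supported in one of the index sets `P s`
is a sum of zero-padded blocks. -/
theorem exists_sum_zeroPad {ι : Type*} [Fintype ι] {m : ℕ} (P : Fin m → Finset (Fin p))
    (t : ι → Fin p → ℝ) (h : ∀ i, t i ≠ 0 → ∃ s, supp (t i) ⊆ P s) :
    ∃ I : Fin m → Finset ι, (∀ s, ∀ i ∈ I s, supp (t i) ⊆ P s) ∧
      ∑ i, vecMulVec (t i) (t i) = ∑ s, zeroPad (∑ i ∈ I s,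
        vecMulVec (restrictTo (P s) (t i)) (restrictTo (P s) (t i))) := by
  classical
  rcases isEmpty_or_nonempty (Fin m) with hm | hm
  · refine ⟨fun _ => ∅, by simp, ?_⟩
    simp only [Finset.sum_empty, zeroPad_zero, Finset.sum_const_zero]
    refine Finset.sum_eq_zero fun i _ => ?_
    have : t i = 0 := by
      by_contra hne
      obtain ⟨s, -⟩ := h i hne
      exact hm.elim s
    simp [this]
  · have h' : ∀ i, ∃ s, supp (t i) ⊆ P s := by
      intro i
      by_cases hi : t i = 0
      · obtain ⟨s⟩ := hm
        exact ⟨s, by simp [supp, hi]⟩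
      · exact h i hi
    choose σ hσ using h'
    have hI : ∀ s, ∀ i ∈ Finset.univ.filter fun i => σ i = s, supp (t i) ⊆ P s := by
      intro s i hi
      rw [← (Finset.mem_filter.1 hi).2]
      exact hσ i
    refine ⟨fun s => Finset.univ.filter fun i => σ i = s, hI, ?_⟩
    rw [← Finset.sum_fiberwise Finset.univ σ]
    refine Finset.sum_congr rfl fun s _ => ?_
    rw [zeroPad_sum]
    refine Finset.sum_congr rfl fun i hi => ?_
    rw [zeroPad_vecMulVec, zeroExtend_restrictTo (hI s i hi)]

end ZeroPad

/-! ### Existence of positive factorizations -/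

section Factorization

variable {Q : Type*} [Fintype Q] {A₀ U : Matrix Q Q ℝ}

theorem exists_hasPositiveFactorization [DecidableEq Q] {a₀ : Q → ℝ} (ha₀ : ∀ k, 0 < a₀ k)
    (h0 : A₀ *ᵥ a₀ = 0) : ∃ V, HasPositiveFactorization A₀ V := by
  obtain ⟨d, Z, L, hAZ, -, hZL⟩ := exists_kernelMatrix A₀
  obtain ⟨η, hη, hpos⟩ := exists_pos_add_smul ha₀ fun i : Fin d => Z *ᵥ Pi.single i 1
  let a : Fin (d + 1) → Q → ℝ := Fin.cons a₀ fun i => a₀ + η • (Z *ᵥ Pi.single i 1)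
  refine ⟨∑ l, vecMulVec (a l) (a l), d, a, ?_, ?_, rfl, ?_⟩
  · intro l
    refine Fin.cases ha₀ (fun i => hpos i) l
  · intro l
    refine Fin.cases h0 (fun i => ?_) l
    change A₀ *ᵥ (a₀ + η • (Z *ᵥ Pi.single i 1)) = 0
    rw [mulVec_add, h0, mulVec_smul, mulVec_mulVec, hAZ, zero_mulVec, smul_zero, add_zero]
  · intro x hx hVx
    have hsum : ∑ l, (a l ⬝ᵥ x) * (a l ⬝ᵥ x) = 0 := by
      have h1 : x ⬝ᵥ ((∑ l, vecMulVec (a l) (a l)) *ᵥ x) = 0 := by rw [hVx, dotProduct_zero]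
      rw [← h1, sum_mulVec, dotProduct_sum]
      refine Finset.sum_congr rfl fun l _ => ?_
      rw [vecMulVec_mulVec, op_smul_eq_smul, dotProduct_smul, smul_eq_mul, dotProduct_comm x]
    have hl : ∀ l, a l ⬝ᵥ x = 0 := fun l => mul_self_eq_zero.1
      ((Finset.sum_eq_zero_iff_of_nonneg fun l _ => mul_self_nonneg _).1 hsum l (Finset.mem_univ l))
    have hZx : Zᵀ *ᵥ x = 0 := by
      ext i
      have h1 : (a₀ + η • (Z *ᵥ Pi.single i 1)) ⬝ᵥ x = 0 := hl i.succ
      have h2 : a₀ ⬝ᵥ x = 0 := hl 0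
      rw [add_dotProduct, h2, zero_add, smul_dotProduct, smul_eq_mul, mul_eq_zero,
        or_iff_right hη.ne', mulVec_single_one] at h1
      exact h1
    rw [← dotProduct_self_eq_zero]
    have h5 : (Z *ᵥ (L *ᵥ x)) ⬝ᵥ x = 0 := by
      rw [dotProduct_comm, dotProduct_mulVec, ← mulVec_transpose, hZx, zero_dotProduct]
    rwa [hZL x hx] at h5

theorem HasPositiveFactorization.smul (h : HasPositiveFactorization A₀ U) {c : ℝ} (hc : 0 < c) :
    HasPositiveFactorization A₀ (c • U) := by
  obtain ⟨N, a, hpos, hker, rfl, hinj⟩ := h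
  refine ⟨N, fun l => Real.sqrt c • a l, fun l k => mul_pos (Real.sqrt_pos.2 hc) (hpos l k),
    fun l => by rw [mulVec_smul, hker, smul_zero], ?_, fun x hx hUx => hinj x hx ?_⟩
  · rw [Finset.smul_sum]
    refine Finset.sum_congr rfl fun l _ => ?_
    rw [smul_vecMulVec, vecMulVec_smul, smul_smul, Real.mul_self_sqrt hc.le]
  · rw [smul_mulVec] at hUx
    exact (smul_eq_zero.1 hUx).resolve_left hc.ne'

/-- A rank-one matrix `b bᵀ` with a nonnegative kernel vector `b` can be absorbed: rotating the pair
`(b, a)` with `a > 0` by a small angle turns `b bᵀ + a aᵀ` into a sum with two positive vectors. -/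
theorem HasPositiveFactorization.add_vecMulVec (h : HasPositiveFactorization A₀ U) {b : Q → ℝ}
    (hb : 0 ≤ b) (hb0 : A₀ *ᵥ b = 0) : HasPositiveFactorization A₀ (U + vecMulVec b b) := by
  have hU := h.posSemidef
  obtain ⟨N, a, hpos, hker, hUa, hinj⟩ := h
  obtain ⟨η, hη, hηpos⟩ := exists_pos_add_smul (hpos 0) fun _ : Unit => -b
  set α := Real.sqrt (1 / (1 + η ^ 2)) with hα
  have hα0 : 0 < α := Real.sqrt_pos.2 (by positivity)
  have hα2 : α * α = 1 / (1 + η ^ 2) := Real.mul_self_sqrt (by positivity)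
  let a' : Fin (N + 2) → Q → ℝ := Fin.cons (α • (b + η • a 0))
    (Fin.cons (α • (a 0 - η • b)) fun l => a l.succ)
  refine ⟨N + 1, a', ?_, ?_, ?_, ?_⟩
  · refine Fin.cases (fun k => ?_) (Fin.cases (fun k => ?_) fun l => hpos l.succ)
    · exact mul_pos hα0 (add_pos_of_nonneg_of_pos (hb k) (mul_pos hη (hpos 0 k)))
    · refine mul_pos hα0 ?_
      have := hηpos () k
      simpa [sub_eq_add_neg] using this
  · refine Fin.cases ?_ (Fin.cases ?_ fun l => hker l.succ)
    · change A₀ *ᵥ (α • (b + η • a 0)) = 0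
      rw [mulVec_smul, mulVec_add, mulVec_smul, hker, hb0]
      simp
    · change A₀ *ᵥ (α • (a 0 - η • b)) = 0
      rw [mulVec_smul, mulVec_sub, mulVec_smul, hker, hb0]
      simp
  · rw [Fin.sum_univ_succ, Fin.sum_univ_succ, hUa, Fin.sum_univ_succ]
    change vecMulVec (a 0) (a 0) + ∑ l : Fin N, vecMulVec (a l.succ) (a l.succ) + vecMulVec b b =
      vecMulVec (α • (b + η • a 0)) (α • (b + η • a 0)) +
      (vecMulVec (α • (a 0 - η • b)) (α • (a 0 - η • b)) +
        ∑ l : Fin N, vecMulVec (a l.succ) (a l.succ))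
    have : vecMulVec (α • (b + η • a 0)) (α • (b + η • a 0)) +
        vecMulVec (α • (a 0 - η • b)) (α • (a 0 - η • b)) =
        vecMulVec (a 0) (a 0) + vecMulVec b b := by
      ext i j
      have hα3 : α * α * (1 + η ^ 2) = 1 := by
        rw [hα2]
        field_simp
      simp only [vecMulVec_apply, Matrix.add_apply, Pi.smul_apply, Pi.add_apply, Pi.sub_apply,
        smul_eq_mul]
      linear_combination (a 0 i * a 0 j + b i * b j) * hα3
    rw [← add_assoc, this]
    abel
  · intro x hx hUx
    refine hinj x hx (mulVec_eq_zero_of_posSemidef hU ?_)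
    have h1 : x ⬝ᵥ ((U + vecMulVec b b) *ᵥ x) = 0 := by rw [hUx, dotProduct_zero]
    rw [add_mulVec, dotProduct_add, vecMulVec_mulVec, op_smul_eq_smul, dotProduct_smul,
      smul_eq_mul, dotProduct_comm x b] at h1
    have h2 := (posSemidef_iff_real.1 hU).2 x
    nlinarith [mul_self_nonneg (b ⬝ᵥ x)]

theorem HasPositiveFactorization.add_sum_vecMulVec (h : HasPositiveFactorization A₀ U)
    {ι : Type*} (s : Finset ι) (b : ι → Q → ℝ) (hb : ∀ i ∈ s, 0 ≤ b i)
    (hb0 : ∀ i ∈ s, A₀ *ᵥ b i = 0) :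
    HasPositiveFactorization A₀ (U + ∑ i ∈ s, vecMulVec (b i) (b i)) := by
  classical
  induction s using Finset.induction_on with
  | empty => simpa using h
  | insert i s hi ih =>
    rw [Finset.sum_insert hi, add_comm (vecMulVec (b i) (b i)), ← add_assoc]
    exact (ih (fun j hj => hb j (Finset.mem_insert_of_mem hj))
      fun j hj => hb0 j (Finset.mem_insert_of_mem hj)).add_vecMulVec
        (hb i (Finset.mem_insert_self i s)) (hb0 i (Finset.mem_insert_self i s))

end Factorization

/-! ### The blocks of a vertex cover -/

section Blocks

variable {p n m : ℕ} {X : Matrix (Fin p) (Fin p) ℝ} {τ : Fin n → Fin p → ℝ}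
  {J Jb : Fin m → Finset (Fin n)}

/-- The sum of the vertices of a block is a kernel vector that is positive on the whole block. -/
theorem exists_pos_kernel_vector (hτ : IsVertexList X τ) (hJ : IsZeroCover X τ J) (s : Fin m) :
    ∃ a : indexP τ (J s) → ℝ, (∀ k, 0 < a k) ∧ principal X (indexP τ (J s)) *ᵥ a = 0 ∧
      zeroExtend a ∈ Submodule.span ℝ (τ '' (J s : Set (Fin n))) := by
  have hsub : ∀ j ∈ J s, supp (τ j) ⊆ indexP τ (J s) := fun j hj =>
    Finset.subset_biUnion_of_mem (fun j => supp (τ j)) hj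
  have hsupp : supp (∑ j ∈ J s, τ j) ⊆ indexP τ (J s) := by
    intro k hk
    rw [mem_supp, Finset.sum_apply] at hk
    obtain ⟨j, hj, hjk⟩ := Finset.exists_ne_zero_of_sum_ne_zero hk
    exact hsub j hj (mem_supp.2 hjk)
  refine ⟨restrictTo _ (∑ j ∈ J s, τ j), ?_, ?_, ?_⟩
  · rintro ⟨k, hk⟩
    obtain ⟨j, hj, hjk⟩ := Finset.mem_biUnion.1 hk
    change 0 < (∑ j ∈ J s, τ j) k
    rw [Finset.sum_apply]
    exact Finset.sum_pos' (fun i _ => (hτ.mem_normalizedZeros i).1 k) ⟨j, hj,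
      lt_of_le_of_ne ((hτ.mem_normalizedZeros j).1 k) (Ne.symm (mem_supp.1 hjk))⟩
  · rw [principal_mulVec, zeroExtend_restrictTo hsupp]
    ext ⟨k, hk⟩
    change (X *ᵥ ∑ j ∈ J s, τ j) k = 0
    rw [mulVec_sum, Finset.sum_apply]
    exact Finset.sum_eq_zero fun j hj => mem_indexM.1 (hJ.supp_subset s j hj hk)
  · rw [zeroExtend_restrictTo hsupp]
    exact Submodule.sum_mem _ fun j hj => Submodule.subset_span ⟨j, hj, rfl⟩

theorem principal_copositive (hX : X ∈ cop p) (Q : Finset (Fin p)) (x : Q → ℝ) (hx : 0 ≤ x) :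
    0 ≤ x ⬝ᵥ (principal X Q *ᵥ x) := by
  rw [dotProduct_principal_mulVec]
  exact hX.2 _ (zeroExtend_nonneg hx)

theorem posSemidef_principal (hX : X ∈ cop p) (hτ : IsVertexList X τ) (hJ : IsZeroCover X τ J)
    (s : Fin m) : (principal X (indexP τ (J s))).PosSemidef := by
  obtain ⟨a, ha, h0, -⟩ := exists_pos_kernel_vector hτ hJ s
  exact posSemidef_of_pos_zero (isSymm_principal hX.1) (principal_copositive hX _) ha
    (by rw [h0, dotProduct_zero])

/-- Kernel vectors of the principal submatrix on a block are combinations of the vertices of the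
block. -/
theorem zeroExtend_mem_span (hX : X ∈ cop p) (hτ : IsVertexList X τ) (hJ : IsZeroCover X τ J)
    (h3 : ∀ s, ∀ j ∈ J s, indexM X τ j = indexP τ (J s)) (s : Fin m)
    {x : indexP τ (J s) → ℝ} (hx : principal X (indexP τ (J s)) *ᵥ x = 0) :
    zeroExtend x ∈ Submodule.span ℝ (τ '' (J s : Set (Fin n))) := by
  obtain ⟨a, ha, h0, hspan⟩ := exists_pos_kernel_vector hτ hJ s
  obtain ⟨η, hη, hpos⟩ := exists_pos_add_smul ha fun _ : Unit => x
  have hax : principal X (indexP τ (J s)) *ᵥ (a + η • x) = 0 := by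
    rw [mulVec_add, mulVec_smul, h0, hx, smul_zero, add_zero]
  -- The vector `a + η x` is positive, so it can vanish only if the block is empty.
  by_cases hne : zeroExtend (a + η • x) = 0
  · have hemp : ∀ k : indexP τ (J s), False := by
      intro k
      have h1 := congrFun hne k
      rw [zeroExtend_coe] at h1
      exact (hpos () k).ne' h1
    have : zeroExtend x = 0 := by
      ext k
      by_cases hk : k ∈ indexP τ (J s)
      · exact (hemp ⟨k, hk⟩).elim
      · exact zeroExtend_of_notMem x hk
    rw [this]
    exact Submodule.zero_mem _
  · obtain ⟨r, hr, hrspan⟩ := exists_block_of_zero hX hτ hJ h3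
      (zeroExtend_nonneg (x := a + η • x) fun k => (hpos () k).le) hne
      (by rw [← dotProduct_principal_mulVec, hax, dotProduct_zero])
    have hsub : indexP τ (J s) ⊆ indexP τ (J r) := by
      intro k hk
      rw [← hr]
      have := congrFun hax ⟨k, hk⟩
      rwa [principal_mulVec] at this
    have hJsub : J s ⊆ J r := fun j hj => hJ.mem_of_supp_subset fun i hi => by
      rw [h3 r i hi]
      exact (Finset.subset_biUnion_of_mem (fun j => supp (τ j)) hj).trans hsub
    have hsr : s = r := by
      by_contra hcon
      exact (Finset.sdiff_nonempty.1 (hJ.separated s r hcon).1) hJsub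
    subst hsr
    have hxe : zeroExtend x = η⁻¹ • (zeroExtend (a + η • x) - zeroExtend a) := by
      rw [zeroExtend_add, zeroExtend_smul, add_sub_cancel_left, smul_smul, inv_mul_cancel₀ hη.ne',
        one_smul]
    rw [hxe]
    exact Submodule.smul_mem _ _ (Submodule.sub_mem _ hrspan hspan)

theorem IsRankBasis.span_eq {I Ib : Finset (Fin n)} (h : IsRankBasis τ I Ib) :
    Submodule.span ℝ (τ '' (Ib : Set (Fin n))) = Submodule.span ℝ (τ '' (I : Set (Fin n))) :=
  Submodule.eq_of_le_of_finrank_eq (Submodule.span_mono (Set.image_mono (by exact_mod_cast h.1)))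
    h.2.1.symm

/-- Polarization: symmetrized products of combinations of the vertices `τ i`, `i ∈ I`, are
combinations of the matrices `(τ i + τ j) (τ i + τ j)ᵀ`, `i ≤ j`. -/
theorem vecMulVec_add_swap_mem_span (I : Finset (Fin n)) {x y : Fin p → ℝ}
    (hx : x ∈ Submodule.span ℝ (τ '' (I : Set (Fin n))))
    (hy : y ∈ Submodule.span ℝ (τ '' (I : Set (Fin n)))) :
    vecMulVec x y + vecMulVec y x ∈ Submodule.span ℝ (Set.range fun q : pairsV I =>
      vecMulVec (τ q.1.1 + τ q.1.2) (τ q.1.1 + τ q.1.2)) := by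
  set S := Submodule.span ℝ (Set.range fun q : pairsV I =>
      vecMulVec (τ q.1.1 + τ q.1.2) (τ q.1.1 + τ q.1.2)) with hS
  have hpair : ∀ i ∈ I, ∀ j ∈ I, vecMulVec (τ i + τ j) (τ i + τ j) ∈ S := by
    intro i hi j hj
    rcases le_total i j with hij | hij
    · exact Submodule.subset_span ⟨⟨(i, j), by simp [pairsV, hi, hj, hij]⟩, rfl⟩
    · rw [add_comm]
      exact Submodule.subset_span ⟨⟨(j, i), by simp [pairsV, hi, hj, hij]⟩, rfl⟩
  induction hx, hy using Submodule.span_induction₂ with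
  | mem_mem x y hx hy =>
    obtain ⟨i, hi, rfl⟩ := hx
    obtain ⟨j, hj, rfl⟩ := hy
    have : vecMulVec (τ i) (τ j) + vecMulVec (τ j) (τ i) = vecMulVec (τ i + τ j) (τ i + τ j)
        - (1 / 4 : ℝ) • vecMulVec (τ i + τ i) (τ i + τ i)
        - (1 / 4 : ℝ) • vecMulVec (τ j + τ j) (τ j + τ j) := by
      ext k q
      simp only [vecMulVec_apply, Matrix.add_apply, Matrix.sub_apply, Matrix.smul_apply,
        Pi.add_apply, smul_eq_mul]
      ring
    rw [this]
    exact Submodule.sub_mem _ (Submodule.sub_mem _ (hpair i hi j hj)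
      (Submodule.smul_mem _ _ (hpair i hi i hi))) (Submodule.smul_mem _ _ (hpair j hj j hj))
  | zero_left y hy => simp
  | zero_right x hx => simp
  | add_left x y z hx hy hz h1 h2 =>
    convert Submodule.add_mem _ h1 h2 using 1
    rw [add_vecMulVec, vecMulVec_add]
    abel
  | add_right x y z hx hy hz h1 h2 =>
    convert Submodule.add_mem _ h1 h2 using 1
    rw [add_vecMulVec, vecMulVec_add]
    abel
  | smul_left r x y hx hy h =>
    convert Submodule.smul_mem _ r h using 1
    rw [smul_vecMulVec, vecMulVec_smul, smul_add]
  | smul_right r x y hx hy h =>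
    convert Submodule.smul_mem _ r h using 1
    rw [smul_vecMulVec, vecMulVec_smul, smul_add]

theorem zeroPad_mem_span {Q : Finset (Fin p)} {I : Finset (Fin n)}
    (hker : ∀ x : Q → ℝ, principal X Q *ᵥ x = 0 →
      zeroExtend x ∈ Submodule.span ℝ (τ '' (I : Set (Fin n))))
    {W : Matrix Q Q ℝ} (hW : W.IsSymm) (h0 : principal X Q * W = 0) :
    zeroPad W ∈ Submodule.span ℝ (Set.range fun q : pairsV I =>
      vecMulVec (τ q.1.1 + τ q.1.2) (τ q.1.1 + τ q.1.2)) := by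
  obtain ⟨d, Z, L, hAZ, -, hZL⟩ := exists_kernelMatrix (principal X Q)
  have hZW : Z * L * W = W := by
    refine Matrix.ext_of_mulVec_single fun j => ?_
    rw [← mulVec_mulVec, ← mulVec_mulVec, hZL _ (by rw [mulVec_mulVec, h0, zero_mulVec])]
  have hZW' : W * (Z * L)ᵀ = W := by
    have := congrArg transpose hZW
    rwa [transpose_mul, hW.eq] at this
  set w := L * W * Lᵀ with hw
  have hwsymm : wᵀ = w := by
    rw [hw, transpose_mul, transpose_mul, transpose_transpose, hW.eq, Matrix.mul_assoc]
  have hWw : W = Z * w * Zᵀ := by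
    conv_lhs => rw [← hZW', ← hZW]
    rw [hw, transpose_mul]
    simp only [Matrix.mul_assoc]
  have hsum : (2 : ℝ) • W = ∑ i, ∑ j, w i j •
      (vecMulVec (Z.col i) (Z.col j) + vecMulVec (Z.col j) (Z.col i)) := by
    have h1 : W = ∑ i, ∑ j, w i j • vecMulVec (Z.col i) (Z.col j) := by
      ext k q
      rw [hWw]
      simp only [mul_apply, Finset.sum_mul, Matrix.sum_apply, Matrix.smul_apply, vecMulVec_apply,
        transpose_apply, smul_eq_mul, col_apply]
      rw [Finset.sum_comm]
      exact Finset.sum_congr rfl fun i _ => Finset.sum_congr rfl fun j _ => by ring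
    have h2 : W = ∑ i, ∑ j, w i j • vecMulVec (Z.col j) (Z.col i) := by
      conv_lhs => rw [h1]
      rw [Finset.sum_comm]
      refine Finset.sum_congr rfl fun i _ => Finset.sum_congr rfl fun j _ => ?_
      rw [show w j i = w i j from congrFun (congrFun hwsymm i) j]
    simp only [smul_add, Finset.sum_add_distrib]
    rw [← h1, ← h2, two_smul]
  have hW2 : zeroPad W = (1 / 2 : ℝ) • zeroPad ((2 : ℝ) • W) := by
    rw [zeroPad_smul, smul_smul]
    norm_num
  have hcol : ∀ i, zeroExtend (Z.col i) ∈ Submodule.span ℝ (τ '' (I : Set (Fin n))) := by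
    intro i
    refine hker _ ?_
    rw [← mulVec_single_one, mulVec_mulVec, hAZ, zero_mulVec]
  rw [hW2, hsum, zeroPad_sum]
  refine Submodule.smul_mem _ _ (Submodule.sum_mem _ fun i _ => ?_)
  rw [zeroPad_sum]
  refine Submodule.sum_mem _ fun j _ => ?_
  rw [zeroPad_smul, zeroPad_add, zeroPad_vecMulVec, zeroPad_vecMulVec]
  exact Submodule.smul_mem _ _ (vecMulVec_add_swap_mem_span I (hcol i) (hcol j))

/-- Nondegeneracy says that the spaces of symmetric matrices on the kernels of the blocks are
independent. -/
theorem IsNondegenerate.eq_zero_of_sum_eq_zero (h2 : IsNondegenerate τ Jb)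
    {P : Fin m → Finset (Fin p)}
    (hker : ∀ s, ∀ x : P s → ℝ, principal X (P s) *ᵥ x = 0 →
      zeroExtend x ∈ Submodule.span ℝ (τ '' (Jb s : Set (Fin n))))
    {W : ∀ s, Matrix (P s) (P s) ℝ} (hW : ∀ s, (W s).IsSymm)
    (h0 : ∀ s, principal X (P s) * W s = 0) (hsum : ∑ s, zeroPad (W s) = 0) (s : Fin m) :
    W s = 0 := by
  have h := fun s => (Submodule.mem_span_range_iff_exists_fun ℝ).1
    (zeroPad_mem_span (hker s) (hW s) (h0 s))
  choose c hc using h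
  have hlin := Fintype.linearIndependent_iff.1 h2 (fun x => c x.1 x.2) (by
    rw [Fintype.sum_sigma, ← hsum]
    exact Finset.sum_congr rfl fun s _ => hc s)
  refine zeroPad_injective ?_
  rw [zeroPad_zero, ← hc s]
  exact Finset.sum_eq_zero fun q _ => by rw [hlin ⟨s, q⟩, zero_smul]

/-- A point of the relative interior of the face `CP ∩ Xᗮ` dominates a positive multiple of every
member of the face. -/
theorem IsStrictlyComplementary.exists_eq_add_smul {U V : Matrix (Fin p) (Fin p) ℝ}
    (hU : IsStrictlyComplementary U X) (hV : V ∈ cp p) (hXV : ip X V = 0) :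
    ∃ c : ℝ, 0 < c ∧ ∃ K ∈ cp p, ip X K = 0 ∧ U = c • V + K := by
  let F : Set (Matrix (Fin p) (Fin p) ℝ) := {V | V ∈ cp p ∧ ip X V = 0}
  have hUF : U ∈ intrinsicInterior ℝ F := hU
  obtain ⟨y, hy, rfl⟩ := mem_intrinsicInterior.1 hUF
  have hVF : V ∈ affineSpan ℝ F := subset_affineSpan ℝ F ⟨hV, hXV⟩
  let f : ℝ → affineSpan ℝ F := fun δ =>
    ⟨AffineMap.lineMap (y : Matrix (Fin p) (Fin p) ℝ) V (-δ), AffineMap.lineMap_mem _ y.2 hVF⟩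
  have hf : Continuous f := by
    refine Continuous.subtype_mk ?_ _
    simp only [AffineMap.lineMap_apply_module]
    fun_prop
  have hf0 : f 0 = y := by
    ext1
    simp [f]
  have hev : ∀ᶠ δ in 𝓝[>] (0 : ℝ), f δ ∈ ((↑) ⁻¹' F : Set (affineSpan ℝ F)) := by
    refine ((hf.tendsto 0).mono_left nhdsWithin_le_nhds).eventually ?_
    rw [hf0]
    exact mem_interior_iff_mem_nhds.1 hy
  obtain ⟨δ, hδ, hδ0⟩ := (hev.and self_mem_nhdsWithin).exists
  have hδ0 : 0 < δ := hδ0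
  obtain ⟨h1, h2⟩ : AffineMap.lineMap (y : Matrix (Fin p) (Fin p) ℝ) V (-δ) ∈ F := hδ
  refine ⟨δ / (1 + δ), by positivity, (1 / (1 + δ)) •
    AffineMap.lineMap (y : Matrix (Fin p) (Fin p) ℝ) V (-δ),
    PointedCone.smul_mem _ (by positivity) h1, ?_, ?_⟩
  · rw [ip, Matrix.mul_smul, trace_smul]
    change _ • ip X _ = 0
    rw [h2, smul_zero]
  · rw [AffineMap.lineMap_apply_module]
    ext i j
    simp only [Matrix.add_apply, Matrix.smul_apply, smul_eq_mul]
    field_simp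
    ring

theorem zeroPad_sum_vecMulVec_mem_cp {Q : Finset (Fin p)} {ι : Type*} (s : Finset ι)
    {a : ι → Q → ℝ} (ha : ∀ l ∈ s, 0 ≤ a l) : zeroPad (∑ l ∈ s, vecMulVec (a l) (a l)) ∈ cp p := by
  rw [zeroPad_sum]
  refine Submodule.sum_mem _ fun l hl => ?_
  rw [zeroPad_vecMulVec]
  exact Submodule.subset_span ⟨_, zeroExtend_nonneg (ha l hl), rfl⟩

theorem exists_supp_subset_of_zero (hX : X ∈ cop p) (hτ : IsVertexList X τ)
    (hJ : IsZeroCover X τ J) (h3 : ∀ s, ∀ j ∈ J s, indexM X τ j = indexP τ (J s))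
    {t : Fin p → ℝ} (ht : 0 ≤ t) (hne : t ≠ 0) (h0 : t ⬝ᵥ (X *ᵥ t) = 0) :
    ∃ s, supp t ⊆ indexP τ (J s) := by
  obtain ⟨s, hs, -⟩ := exists_block_of_zero hX hτ hJ h3 ht hne h0
  refine ⟨s, fun k hk => (hs k).1 ?_⟩
  exact (mul_eq_zero.1 (mul_mulVec_eq_zero hX ht h0 k)).resolve_left (mem_supp.1 hk)

/-- Vectors of a completely positive factorization of `U` are zeros of `X` if `X • U = 0`. -/
theorem exists_zeros_of_mem_cp {U : Matrix (Fin p) (Fin p) ℝ} (hX : X ∈ cop p) (hU : U ∈ cp p)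
    (h0 : ip X U = 0) : ∃ (N : ℕ) (B : Fin N → Fin p → ℝ), (∀ i, 0 ≤ B i) ∧
      (∀ i, B i ⬝ᵥ (X *ᵥ B i) = 0) ∧ U = ∑ i, vecMulVec (B i) (B i) := by
  obtain ⟨B, hB, rfl⟩ := mem_cp_iff.1 hU
  refine ⟨_, B, hB, fun i => ?_, rfl⟩
  simp only [ip_sum_right, ip_vecMulVec_right] at h0
  exact (Finset.sum_eq_zero_iff_of_nonneg (fun i _ => hX.2 _ (hB i))).1 h0 i (Finset.mem_univ i)

/-- A strictly complementary `U` is a sum of zero-padded blocks that have a positive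
factorization. -/
theorem IsStrictlyComplementary.exists_blocks {U : Matrix (Fin p) (Fin p) ℝ}
    (hU : IsStrictlyComplementary U X) (hX : X ∈ cop p) (hτ : IsVertexList X τ)
    (hJ : IsZeroCover X τ J) (h3 : ∀ s, ∀ j ∈ J s, indexM X τ j = indexP τ (J s)) :
    ∃ W : ∀ s : Fin m, Matrix (indexP τ (J s)) (indexP τ (J s)) ℝ,
      (∀ s, HasPositiveFactorization (principal X (indexP τ (J s))) (W s)) ∧
      U = ∑ s, zeroPad (W s) := by
  have hV : ∀ s, ∃ V, HasPositiveFactorization (principal X (indexP τ (J s))) V := by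
    intro s
    obtain ⟨a, ha, h0, -⟩ := exists_pos_kernel_vector hτ hJ s
    exact exists_hasPositiveFactorization ha h0
  choose V hV using hV
  have hVcp : ∑ s, zeroPad (V s) ∈ cp p := by
    refine Submodule.sum_mem _ fun s _ => ?_
    obtain ⟨N, a, hpos, -, hVa, -⟩ := hV s
    rw [hVa]
    exact zeroPad_sum_vecMulVec_mem_cp _ fun l _ k => (hpos l k).le
  have hXV : ip X (∑ s, zeroPad (V s)) = 0 := by
    rw [ip_sum_right]
    refine Finset.sum_eq_zero fun s _ => ?_
    obtain ⟨N, a, -, hker, hVa, -⟩ := hV s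
    rw [ip_zeroPad, hVa, Matrix.mul_sum, trace_sum]
    refine Finset.sum_eq_zero fun l _ => ?_
    rw [trace_mul_vecMulVec_self, hker, dotProduct_zero]
  obtain ⟨c, hc, K, hK, hXK, rfl⟩ := hU.exists_eq_add_smul hVcp hXV
  obtain ⟨N, B, hB, hB0, rfl⟩ := exists_zeros_of_mem_cp hX hK hXK
  obtain ⟨I, hI, hsum⟩ := exists_sum_zeroPad (fun s => indexP τ (J s)) B fun i hi =>
    exists_supp_subset_of_zero hX hτ hJ h3 (hB i) hi (hB0 i)
  refine ⟨fun s => c • V s + ∑ i ∈ I s, vecMulVec (restrictTo (indexP τ (J s)) (B i))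
    (restrictTo (indexP τ (J s)) (B i)), fun s => ?_, ?_⟩
  · refine ((hV s).smul hc).add_sum_vecMulVec _ _ (fun i _ k => hB i k) fun i hi => ?_
    refine mulVec_eq_zero_of_posSemidef (posSemidef_principal hX hτ hJ s) ?_
    rw [dotProduct_principal_mulVec, zeroExtend_restrictTo (hI s i hi), hB0]
  · rw [hsum, Finset.smul_sum, ← Finset.sum_add_distrib]
    exact Finset.sum_congr rfl fun s _ => by rw [zeroPad_add, zeroPad_smul]

end Blocks

/-! ### Localization near the reference pair -/

section Localization

/-- If a closed relation `R` has at most the solution `w₀` in the compact set `K` over `y₀`, its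
solutions in `K` over nearby points are near `w₀`. -/
theorem eventually_mem_of_unique {Y T : Type*} [TopologicalSpace Y] [TopologicalSpace T]
    {y₀ : Y} {w₀ : T} {K : Set T} (hK : IsCompact K) {R : Set (Y × T)} (hR : IsClosed R)
    (huniq : ∀ w ∈ K, (y₀, w) ∈ R → w = w₀) {O : Set T} (hO : O ∈ 𝓝 w₀) :
    ∀ᶠ y in 𝓝 y₀, ∀ w ∈ K, (y, w) ∈ R → w ∈ O := by
  have key : ∀ᶠ y in 𝓝 y₀, ∀ w ∈ K \ interior O, (y, w) ∉ R := by
    refine (hK.diff isOpen_interior).eventually_forall_of_forall_eventually fun w hw => ?_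
    refine hR.isOpen_compl.mem_nhds fun hwR => hw.2 ?_
    rw [huniq w hw.1 hwR]
    exact mem_interior_iff_mem_nhds.2 hO
  filter_upwards [key] with y hy w hwK hwR
  by_contra hcon
  exact hy w ⟨hwK, fun h => hcon (interior_subset h)⟩ hwR

variable {p m : ℕ} {P : Fin m → Finset (Fin p)}

theorem isCompact_setOf_entries_mem_Icc (P : Fin m → Finset (Fin p)) (C : ℝ) :
    IsCompact {W : ∀ s, Matrix (P s) (P s) ℝ | ∀ s k q, W s k q ∈ Set.Icc (-C) C} := by
  have h : ∀ s, IsCompact {M : Matrix (P s) (P s) ℝ | ∀ k q, M k q ∈ Set.Icc (-C) C} := by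
    intro s
    change IsCompact ({M | ∀ k q, M k q ∈ Set.Icc (-C) C} : Set (P s → P s → ℝ))
    have h1 : IsCompact (Set.univ.pi fun _ : P s => Set.univ.pi fun _ : P s => Set.Icc (-C) C) :=
      isCompact_univ_pi fun _ => isCompact_univ_pi fun _ => isCompact_Icc
    convert h1 using 1
    ext M
    simp only [Set.mem_pi, Set.mem_univ, true_implies, Set.mem_ofPred_eq]
  convert isCompact_univ_pi h using 1
  ext W
  simp only [Set.mem_pi, Set.mem_univ, true_implies, Set.mem_ofPred_eq]

/-- The tuples of symmetric blocks that solve the Lyapunov equations for `X` and sum up to `U`. -/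
def lyapunovRelation (P : Fin m → Finset (Fin p)) :
    Set ((Matrix (Fin p) (Fin p) ℝ × Matrix (Fin p) (Fin p) ℝ) × ∀ s, Matrix (P s) (P s) ℝ) :=
  {z | (∀ s, (z.2 s).IsSymm) ∧
    (∀ s, principal z.1.1 (P s) * z.2 s + z.2 s * principal z.1.1 (P s) = 0) ∧
    z.1.2 = ∑ s, zeroPad (z.2 s)}

/-- The tuples of positive semidefinite blocks that are orthogonal to the blocks of `X` and sum up
to `U`. -/
def complementaryRelation (P : Fin m → Finset (Fin p)) :
    Set ((Matrix (Fin p) (Fin p) ℝ × Matrix (Fin p) (Fin p) ℝ) × ∀ s, Matrix (P s) (P s) ℝ) :=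
  {z | (∀ s, (z.2 s).PosSemidef) ∧ (∀ s, (principal z.1.1 (P s) * z.2 s).trace = 0) ∧
    z.1.2 = ∑ s, zeroPad (z.2 s)}

theorem continuous_principal (Q : Finset (Fin p)) :
    Continuous fun X : Matrix (Fin p) (Fin p) ℝ => principal X Q :=
  continuous_id.matrix_submatrix _ _

theorem isClosed_eq_sum_zeroPad : IsClosed {z : (Matrix (Fin p) (Fin p) ℝ ×
    Matrix (Fin p) (Fin p) ℝ) × ∀ s, Matrix (P s) (P s) ℝ | z.1.2 = ∑ s, zeroPad (z.2 s)} := by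
  refine isClosed_eq (by fun_prop) (continuous_finsetSum _ fun s _ => ?_)
  exact continuous_zeroPad.comp ((continuous_apply s).comp continuous_snd)

theorem isClosed_lyapunovRelation : IsClosed (lyapunovRelation P) := by
  have hp : ∀ s, Continuous fun z : (Matrix (Fin p) (Fin p) ℝ × Matrix (Fin p) (Fin p) ℝ) ×
      ∀ s, Matrix (P s) (P s) ℝ => principal z.1.1 (P s) := fun s =>
    (continuous_principal (P s)).comp (continuous_fst.comp continuous_fst)
  have hw : ∀ s, Continuous fun z : (Matrix (Fin p) (Fin p) ℝ × Matrix (Fin p) (Fin p) ℝ) ×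
      ∀ s, Matrix (P s) (P s) ℝ => z.2 s := fun s => (continuous_apply s).comp continuous_snd
  have heq : lyapunovRelation P = (⋂ s, {z | (z.2 s)ᵀ = z.2 s}) ∩
      ((⋂ s, {z | principal z.1.1 (P s) * z.2 s + z.2 s * principal z.1.1 (P s) = 0}) ∩
        {z | z.1.2 = ∑ s, zeroPad (z.2 s)}) := by
    ext z
    simp only [lyapunovRelation, IsSymm, Set.mem_inter_iff, Set.mem_iInter, Set.mem_ofPred_eq]
  rw [heq]
  refine IsClosed.inter ?_ (IsClosed.inter ?_ isClosed_eq_sum_zeroPad)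
  · exact isClosed_iInter fun s => isClosed_eq (hw s).matrix_transpose (hw s)
  · exact isClosed_iInter fun s => isClosed_eq
      (((hp s).matrix_mul (hw s)).add ((hw s).matrix_mul (hp s))) continuous_const

theorem isClosed_complementaryRelation : IsClosed (complementaryRelation P) := by
  have hp : ∀ s, Continuous fun z : (Matrix (Fin p) (Fin p) ℝ × Matrix (Fin p) (Fin p) ℝ) ×
      ∀ s, Matrix (P s) (P s) ℝ => principal z.1.1 (P s) := fun s =>
    (continuous_principal (P s)).comp (continuous_fst.comp continuous_fst)
  have hw : ∀ s, Continuous fun z : (Matrix (Fin p) (Fin p) ℝ × Matrix (Fin p) (Fin p) ℝ) ×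
      ∀ s, Matrix (P s) (P s) ℝ => z.2 s := fun s => (continuous_apply s).comp continuous_snd
  have heq : complementaryRelation P =
      ((⋂ s, {z | (z.2 s)ᵀ = z.2 s}) ∩ (⋂ s, ⋂ x, {z | 0 ≤ x ⬝ᵥ (z.2 s *ᵥ x)})) ∩
      ((⋂ s, {z | (principal z.1.1 (P s) * z.2 s).trace = 0}) ∩
        {z | z.1.2 = ∑ s, zeroPad (z.2 s)}) := by
    ext z
    simp only [complementaryRelation, posSemidef_iff_real, IsSymm, Set.mem_inter_iff,
      Set.mem_iInter, Set.mem_ofPred_eq, forall_and]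
  rw [heq]
  refine IsClosed.inter (IsClosed.inter ?_ ?_) (IsClosed.inter ?_ isClosed_eq_sum_zeroPad)
  · exact isClosed_iInter fun s => isClosed_eq (hw s).matrix_transpose (hw s)
  · exact isClosed_iInter fun s => isClosed_iInter fun x => isClosed_le continuous_const
      (continuous_const.dotProduct ((hw s).matrix_mulVec continuous_const))
  · exact isClosed_iInter fun s => isClosed_eq ((hp s).matrix_mul (hw s)).matrix_trace
      continuous_const

/-- If the homogeneous problem at `X₀` has only the trivial solution, the solutions of the Lyapunov
problems near `(X₀, U₀)` are uniformly bounded: after scaling, large solutions would accumulate at a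
nontrivial homogeneous solution. -/
theorem exists_bound_of_lyapunov {X₀ : Matrix (Fin p) (Fin p) ℝ} (U₀ : Matrix (Fin p) (Fin p) ℝ)
    (hinj : ∀ W, ((X₀, 0), W) ∈ lyapunovRelation P → W = 0) :
    ∃ C : ℝ, ∀ᶠ z in 𝓝 (X₀, U₀), ∀ W, (z, W) ∈ lyapunovRelation P →
      ∀ s k q, W s k q ∈ Set.Icc (-C) C := by
  let ρ : (∀ s, Matrix (P s) (P s) ℝ) → ℝ := fun W => ∑ s, ∑ k, ∑ q, |W s k q|
  have hρ : Continuous ρ := by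
    refine continuous_finsetSum _ fun s _ => continuous_finsetSum _ fun k _ =>
      continuous_finsetSum _ fun q _ => ?_
    have : Continuous fun W : ∀ s, Matrix (P s) (P s) ℝ => W s := continuous_apply s
    fun_prop
  have hentry : ∀ W s k q, |W s k q| ≤ ρ W := by
    intro W s k q
    refine le_trans ?_ (Finset.single_le_sum (f := fun s => ∑ k, ∑ q, |W s k q|)
      (fun s _ => Finset.sum_nonneg fun k _ => Finset.sum_nonneg fun q _ => abs_nonneg _)
      (Finset.mem_univ s))
    refine le_trans ?_ (Finset.single_le_sum (f := fun k => ∑ q, |W s k q|)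
      (fun k _ => Finset.sum_nonneg fun q _ => abs_nonneg _) (Finset.mem_univ k))
    exact Finset.single_le_sum (f := fun q => |W s k q|) (fun q _ => abs_nonneg _)
      (Finset.mem_univ q)
  have hK := (isCompact_setOf_entries_mem_Icc P 1).inter_right
    (isClosed_eq hρ continuous_const : IsClosed {W | ρ W = 1})
  have hev : ∀ᶠ z in 𝓝 (X₀, (0 : Matrix (Fin p) (Fin p) ℝ)), ∀ W ∈
      {W : ∀ s, Matrix (P s) (P s) ℝ | ∀ s k q, W s k q ∈ Set.Icc (-1) 1} ∩ {W | ρ W = 1},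
      (z, W) ∉ lyapunovRelation P := by
    refine hK.eventually_forall_of_forall_eventually fun W hW => ?_
    refine isClosed_lyapunovRelation.isOpen_compl.mem_nhds fun hWR => ?_
    have h1 : ρ W = 1 := hW.2
    rw [hinj W hWR] at h1
    simp [ρ] at h1
  have hc : Continuous fun z : ℝ × (Matrix (Fin p) (Fin p) ℝ × Matrix (Fin p) (Fin p) ℝ) =>
      (z.2.1, z.1 • z.2.2) := by fun_prop
  have hev2 := (hc.tendsto (0, (X₀, U₀))).eventually (by
    rw [zero_smul]
    exact hev)
  rw [nhds_prod_eq] at hev2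
  obtain ⟨pa, hpa, pb, hpb, hpab⟩ := eventually_prod_iff.1 hev2
  obtain ⟨δ, hδ, hpaδ⟩ := Metric.eventually_nhds_iff.1 hpa
  refine ⟨δ⁻¹, ?_⟩
  filter_upwards [hpb] with z hz W hW
  suffices hρW : ρ W ≤ δ⁻¹ by
    intro s k q
    exact abs_le.1 ((hentry W s k q).trans hρW)
  by_contra! hlt
  have hρ0 : 0 < ρ W := (inv_pos.2 hδ).trans hlt
  have hsc : ρ ((ρ W)⁻¹ • W) = 1 := by
    have : ρ ((ρ W)⁻¹ • W) = (ρ W)⁻¹ * ρ W := by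
      simp only [ρ, Finset.mul_sum]
      refine Finset.sum_congr rfl fun s _ => Finset.sum_congr rfl fun k _ =>
        Finset.sum_congr rfl fun q _ => ?_
      rw [Pi.smul_apply, Matrix.smul_apply, smul_eq_mul, abs_mul, abs_of_pos (inv_pos.2 hρ0)]
    rw [this, inv_mul_cancel₀ hρ0.ne']
  refine hpab (x := (ρ W)⁻¹) (hpaδ ?_) hz ((ρ W)⁻¹ • W) ⟨fun s k q => abs_le.1 ?_, hsc⟩ ?_
  · rw [Real.dist_eq, sub_zero, abs_of_pos (inv_pos.2 hρ0)]
    exact inv_lt_of_inv_lt₀ hδ hlt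
  · rw [← hsc]
    exact hentry _ s k q
  · obtain ⟨h1, h2, h3⟩ := hW
    have hsymm : ∀ s, ((ρ W)⁻¹ • W s).IsSymm := fun s => (h1 s).smul _
    refine ⟨hsymm, fun s => ?_, ?_⟩
    · change principal z.1 (P s) * ((ρ W)⁻¹ • W s) + ((ρ W)⁻¹ • W s) * principal z.1 (P s) = 0
      rw [Matrix.mul_smul, Matrix.smul_mul, ← smul_add, h2 s, smul_zero]
    · change (ρ W)⁻¹ • z.2 = ∑ s, zeroPad ((ρ W)⁻¹ • W s)
      rw [h3, Finset.smul_sum]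
      exact Finset.sum_congr rfl fun s _ => (zeroPad_smul _ _).symm

/-- Conditions that hold near the blocks of `(X₀, W₀)` hold jointly near `X₀` and `W₀`. -/
theorem exists_nhds_blocks {X₀ : Matrix (Fin p) (Fin p) ℝ} {W₀ : ∀ s, Matrix (P s) (P s) ℝ}
    {c : ∀ s, Matrix (P s) (P s) ℝ × Matrix (P s) (P s) ℝ → Prop}
    (h : ∀ s, ∀ᶠ z in 𝓝 (principal X₀ (P s), W₀ s), c s z) :
    ∃ O ∈ 𝓝 W₀, ∀ᶠ X in 𝓝 X₀, ∀ W ∈ O, ∀ s, c s (principal X (P s), W s) := by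
  have hev : ∀ᶠ z : Matrix (Fin p) (Fin p) ℝ × (∀ s, Matrix (P s) (P s) ℝ) in 𝓝 X₀ ×ˢ 𝓝 W₀,
      ∀ s, c s (principal z.1 (P s), z.2 s) := by
    rw [← nhds_prod_eq, eventually_all]
    intro s
    have hc : Continuous fun z : Matrix (Fin p) (Fin p) ℝ × (∀ s, Matrix (P s) (P s) ℝ) =>
        (principal z.1 (P s), z.2 s) :=
      ((continuous_principal (P s)).comp continuous_fst).prodMk
        ((continuous_apply s).comp continuous_snd)
    exact (hc.tendsto (X₀, W₀)).eventually (h s)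
  obtain ⟨pa, hpa, pb, hpb, hpab⟩ := eventually_prod_iff.1 hev
  exact ⟨{W | pb W}, hpb, hpa.mono fun X hX W hW => hpab hX hW⟩

theorem inv_sum_smul_mem_stdSimplex {t : Fin p → ℝ} (ht : 0 ≤ t) (hne : t ≠ 0) :
    (∑ k, t k)⁻¹ • t ∈ stdSimplex ℝ (Fin p) := by
  have hs := sum_pos_of_ne_zero ht hne
  refine ⟨fun k => mul_nonneg (inv_nonneg.2 hs.le) (ht k), ?_⟩
  simp only [Pi.smul_apply, smul_eq_mul, ← Finset.mul_sum]
  exact inv_mul_cancel₀ hs.ne'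

theorem ne_zero_of_mem_stdSimplex {t : Fin p → ℝ} (ht : t ∈ stdSimplex ℝ (Fin p)) : t ≠ 0 := by
  rintro rfl
  simpa using ht.2

/-- Near `X₀`, positive semidefiniteness of the blocks implies copositivity. Near a zero `t₀` of a
block `P s`, the part of `t` outside `P s` contributes nonnegatively because `X t` is positive
there. -/
theorem eventually_mem_cop {X₀ : Matrix (Fin p) (Fin p) ℝ} (hX₀ : X₀ ∈ cop p)
    (hzero : ∀ t, 0 ≤ t → t ≠ 0 → t ⬝ᵥ (X₀ *ᵥ t) = 0 → ∃ s, ∀ k, (X₀ *ᵥ t) k = 0 ↔ k ∈ P s) :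
    ∀ᶠ X in 𝓝 X₀, X.IsSymm → (∀ s, (principal X (P s)).PosSemidef) → X ∈ cop p := by
  have key : ∀ᶠ X in 𝓝 X₀, ∀ t ∈ stdSimplex ℝ (Fin p), X.IsSymm →
      (∀ s, (principal X (P s)).PosSemidef) → 0 ≤ t → 0 ≤ t ⬝ᵥ (X *ᵥ t) := by
    refine (isCompact_stdSimplex ℝ (Fin p)).eventually_forall_of_forall_eventually fun t₀ ht₀ => ?_
    have ht₀nn : 0 ≤ t₀ := ht₀.1
    rcases (hX₀.2 t₀ ht₀nn).lt_or_eq with hpos | h0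
    · have hc : Continuous fun z : Matrix (Fin p) (Fin p) ℝ × (Fin p → ℝ) =>
          z.2 ⬝ᵥ (z.1 *ᵥ z.2) := by fun_prop
      filter_upwards [(hc.tendsto (X₀, t₀)).eventually (lt_mem_nhds hpos)] with z hz _ _ _
      exact hz.le
    · obtain ⟨s, hs⟩ := hzero t₀ ht₀nn (ne_zero_of_mem_stdSimplex ht₀) h0.symm
      have hsupp : supp t₀ ⊆ P s := fun k hk => (hs k).1
        ((mul_eq_zero.1 (mul_mulVec_eq_zero hX₀ ht₀nn h0.symm k)).resolve_left (mem_supp.1 hk))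
      have hcz : Continuous fun t : Fin p → ℝ => zeroExtend (restrictTo (P s) t) := by
        refine continuous_pi fun k => ?_
        by_cases hk : k ∈ P s
        · simp only [zeroExtend, hk, dif_pos, restrictTo]
          fun_prop
        · simp only [zeroExtend, hk, dif_neg, not_false_eq_true]
          fun_prop
      have hev : ∀ᶠ z : Matrix (Fin p) (Fin p) ℝ × (Fin p → ℝ) in 𝓝 (X₀, t₀), ∀ k, k ∉ P s →
          0 < (z.1 *ᵥ (zeroExtend (restrictTo (P s) z.2) + z.2)) k := by
        rw [eventually_all]
        intro k
        by_cases hk : k ∈ P s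
        · exact Eventually.of_forall fun z h => absurd hk h
        have hc : Continuous fun z : Matrix (Fin p) (Fin p) ℝ × (Fin p → ℝ) =>
            (z.1 *ᵥ (zeroExtend (restrictTo (P s) z.2) + z.2)) k :=
          (continuous_apply k).comp (continuous_fst.matrix_mulVec
            ((hcz.comp continuous_snd).add continuous_snd))
        refine ((hc.tendsto (X₀, t₀)).eventually (lt_mem_nhds (a := 0) ?_)).mono fun z hz _ => hz
        have h1 : 0 < (X₀ *ᵥ t₀) k :=
          lt_of_le_of_ne (mulVec_nonneg_of_quadratic_zero hX₀ ht₀nn h0.symm k)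
            fun h => hk ((hs k).1 h.symm)
        simp only [zeroExtend_restrictTo hsupp, mulVec_add, Pi.add_apply]
        linarith
      filter_upwards [hev] with ⟨X, t⟩ hX hsymm hpsd ht
      simp only at hX hsymm hpsd ht ⊢
      set u := zeroExtend (restrictTo (P s) t) with hu
      have hu1 : 0 ≤ u ⬝ᵥ (X *ᵥ u) := by
        rw [hu, ← dotProduct_principal_mulVec]
        exact (posSemidef_iff_real.1 (hpsd s)).2 _
      have hu2 : 0 ≤ (t - u) ⬝ᵥ (X *ᵥ (u + t)) := by
        refine Finset.sum_nonneg fun k _ => ?_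
        by_cases hk : k ∈ P s
        · have : u k = t k := zeroExtend_coe (restrictTo (P s) t) ⟨k, hk⟩
          rw [Pi.sub_apply, this, sub_self, zero_mul]
        · have : u k = 0 := zeroExtend_of_notMem _ hk
          rw [Pi.sub_apply, this, sub_zero]
          exact mul_nonneg (ht k) (hX k hk).le
      -- `t X t = u X u + (t - u) X (u + t)` for symmetric `X`.
      have hsym := dotProduct_mulVec_symm hsymm u t
      rw [mulVec_add, dotProduct_add, sub_dotProduct, sub_dotProduct] at hu2
      linarith
  filter_upwards [key] with X hX hsymm hpsd
  refine ⟨hsymm, fun t ht => ?_⟩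
  by_cases hne : t = 0
  · simp [hne]
  have hs := inv_pos.2 (sum_pos_of_ne_zero ht hne)
  have h1 := hX _ (inv_sum_smul_mem_stdSimplex ht hne) hsymm hpsd (smul_nonneg hs.le ht)
  rw [mulVec_smul, dotProduct_smul, smul_dotProduct, smul_eq_mul, smul_eq_mul, ← mul_assoc] at h1
  exact nonneg_of_mul_nonneg_right h1 (mul_pos hs hs)

/-- Zeros of copositive matrices near `X₀` are supported in one of the index sets `P s`. -/
theorem eventually_supp_subset {X₀ : Matrix (Fin p) (Fin p) ℝ} (hX₀ : X₀ ∈ cop p)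
    (hzero : ∀ t, 0 ≤ t → t ≠ 0 → t ⬝ᵥ (X₀ *ᵥ t) = 0 → ∃ s, ∀ k, (X₀ *ᵥ t) k = 0 ↔ k ∈ P s) :
    ∀ᶠ X in 𝓝 X₀, X ∈ cop p → ∀ t, 0 ≤ t → t ≠ 0 → t ⬝ᵥ (X *ᵥ t) = 0 → ∃ s, supp t ⊆ P s := by
  have key : ∀ᶠ X in 𝓝 X₀, ∀ t ∈ stdSimplex ℝ (Fin p), X ∈ cop p → 0 ≤ t →
      t ⬝ᵥ (X *ᵥ t) = 0 → ∃ s, supp t ⊆ P s := by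
    refine (isCompact_stdSimplex ℝ (Fin p)).eventually_forall_of_forall_eventually fun t₀ ht₀ => ?_
    have ht₀nn : 0 ≤ t₀ := ht₀.1
    rcases (hX₀.2 t₀ ht₀nn).lt_or_eq with hpos | h0
    · have hc : Continuous fun z : Matrix (Fin p) (Fin p) ℝ × (Fin p → ℝ) =>
          z.2 ⬝ᵥ (z.1 *ᵥ z.2) := by fun_prop
      filter_upwards [(hc.tendsto (X₀, t₀)).eventually (lt_mem_nhds hpos)] with z hz _ _ hz0
      exact absurd hz0 (ne_of_gt hz)
    · obtain ⟨s, hs⟩ := hzero t₀ ht₀nn (ne_zero_of_mem_stdSimplex ht₀) h0.symm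
      have hev : ∀ᶠ z : Matrix (Fin p) (Fin p) ℝ × (Fin p → ℝ) in 𝓝 (X₀, t₀), ∀ k, k ∉ P s →
          0 < (z.1 *ᵥ z.2) k := by
        rw [eventually_all]
        intro k
        by_cases hk : k ∈ P s
        · exact Eventually.of_forall fun z h => absurd hk h
        have hc : Continuous fun z : Matrix (Fin p) (Fin p) ℝ × (Fin p → ℝ) =>
            (z.1 *ᵥ z.2) k := by fun_prop
        refine ((hc.tendsto (X₀, t₀)).eventually (lt_mem_nhds (a := 0) ?_)).mono fun z hz _ => hz
        exact lt_of_le_of_ne (mulVec_nonneg_of_quadratic_zero hX₀ ht₀nn h0.symm k)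
            fun h => hk ((hs k).1 h.symm)
      filter_upwards [hev] with ⟨X, t⟩ hX hcop ht hXt
      refine ⟨s, fun k hk => ?_⟩
      by_contra hkP
      exact (mul_ne_zero (mem_supp.1 hk) (hX k hkP).ne') (mul_mulVec_eq_zero hcop ht hXt k)
  filter_upwards [key] with X hX hcop t ht hne hXt
  have hs := inv_pos.2 (sum_pos_of_ne_zero ht hne)
  obtain ⟨s, h⟩ := hX _ (inv_sum_smul_mem_stdSimplex ht hne) hcop (smul_nonneg hs.le ht) (by
    rw [mulVec_smul, dotProduct_smul, smul_dotProduct, hXt, smul_zero, smul_zero])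
  refine ⟨s, fun k hk => h (mem_supp.2 ?_)⟩
  exact mul_ne_zero hs.ne' (mem_supp.1 hk)

theorem ip_self_of_isSymm {M : Matrix (Fin p) (Fin p) ℝ} (hM : M.IsSymm) :
    ip M M = ∑ i, ∑ j, M i j ^ 2 := by
  rw [ip, Matrix.trace]
  refine Finset.sum_congr rfl fun i _ => ?_
  change (M * M) i i = _
  rw [mul_apply]
  refine Finset.sum_congr rfl fun j _ => ?_
  rw [show M j i = M i j from hM.apply i j, sq]

theorem sq_entry_le_ip {M : Matrix (Fin p) (Fin p) ℝ} (hM : M.IsSymm) (i j : Fin p) :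
    M i j ^ 2 ≤ ip M M := by
  rw [ip_self_of_isSymm hM]
  refine le_trans ?_ (Finset.single_le_sum (f := fun i => ∑ j, M i j ^ 2)
    (fun i _ => Finset.sum_nonneg fun j _ => sq_nonneg _) (Finset.mem_univ i))
  exact Finset.single_le_sum (f := fun j => M i j ^ 2) (fun j _ => sq_nonneg _) (Finset.mem_univ j)

theorem abs_entry_le_pairNorm {M N : Matrix (Fin p) (Fin p) ℝ} (hM : M.IsSymm) (hN : N.IsSymm)
    (i j : Fin p) : |M i j| ≤ pairNorm M N ∧ |N i j| ≤ pairNorm M N := by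
  have h1 := sq_entry_le_ip hM i j
  have h2 := sq_entry_le_ip hN i j
  have h3 := (sq_nonneg _).trans h1
  have h4 := (sq_nonneg _).trans h2
  exact ⟨Real.abs_le_sqrt (by linarith), Real.abs_le_sqrt (by linarith)⟩

open scoped Matrix.Norms.Elementwise in
theorem exists_pairNorm_ball {X₀ U₀ : Matrix (Fin p) (Fin p) ℝ} (hX₀ : X₀.IsSymm)
    (hU₀ : U₀.IsSymm) {c : Matrix (Fin p) (Fin p) ℝ × Matrix (Fin p) (Fin p) ℝ → Prop}
    (h : ∀ᶠ z in 𝓝 (X₀, U₀), c z) :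
    ∃ ε₀ : ℝ, 0 < ε₀ ∧ ∀ X U : Matrix (Fin p) (Fin p) ℝ, X.IsSymm → U.IsSymm →
      pairNorm (X - X₀) (U - U₀) ≤ ε₀ → c (X, U) := by
  obtain ⟨ε, hε, hc⟩ := Metric.eventually_nhds_iff.1 h
  refine ⟨ε / 2, by positivity, fun X U hX hU hle => hc ?_⟩
  have hent := abs_entry_le_pairNorm (hX.sub hX₀) (hU.sub hU₀)
  rw [Prod.dist_eq, max_lt_iff, dist_eq_norm, dist_eq_norm]
  refine ⟨(Matrix.norm_lt_iff hε).2 fun i j => ?_, (Matrix.norm_lt_iff hε).2 fun i j => ?_⟩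
  · exact lt_of_le_of_lt ((hent i j).1.trans hle) (by linarith)
  · exact lt_of_le_of_lt ((hent i j).2.trans hle) (by linarith)

/-- The local characterization of the complementarity set, for index sets `P s` that carry the
zeros of `X₀` and blocks `W₀ s` of `U₀` in the relative interior. -/
theorem eventually_mem_complementaritySet_iff {X₀ U₀ : Matrix (Fin p) (Fin p) ℝ}
    (hX₀ : X₀ ∈ cop p)
    (hzero : ∀ t, 0 ≤ t → t ≠ 0 → t ⬝ᵥ (X₀ *ᵥ t) = 0 → ∃ s, ∀ k, (X₀ *ᵥ t) k = 0 ↔ k ∈ P s)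
    (hA₀ : ∀ s, (principal X₀ (P s)).PosSemidef)
    (hinj : ∀ W : ∀ s, Matrix (P s) (P s) ℝ, (∀ s, (W s).IsSymm) →
      (∀ s, principal X₀ (P s) * W s = 0) → ∑ s, zeroPad (W s) = 0 → W = 0)
    {W₀ : ∀ s, Matrix (P s) (P s) ℝ}
    (hW₀ : ∀ s, HasPositiveFactorization (principal X₀ (P s)) (W₀ s))
    (hU₀ : U₀ = ∑ s, zeroPad (W₀ s)) :
    ∀ᶠ z in 𝓝 (X₀, U₀), z.1.IsSymm → (z ∈ complementaritySet p ↔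
      ∃ W : ∀ s : Fin m, Matrix (P s) (P s) ℝ, (∀ s, (W s).IsSymm) ∧
        (∀ s, principal z.1 (P s) * W s + W s * principal z.1 (P s) = 0) ∧
        z.2 = ∑ s, zeroPad (W s)) := by
  have hW₀symm : ∀ s, (W₀ s).IsSymm := fun s => (posSemidef_iff_real.1 (hW₀ s).posSemidef).1
  have hker₀ : ∀ s, principal X₀ (P s) * W₀ s = 0 := by
    intro s
    obtain ⟨N, a, -, hker, hWa, -⟩ := hW₀ s
    rw [hWa, Matrix.mul_sum]
    exact Finset.sum_eq_zero fun l _ => by rw [mul_vecMulVec, hker, zero_vecMulVec]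
  -- The decomposition of `U₀` into blocks that are annihilated by the blocks of `X₀` is unique.
  have huniq : ∀ W : ∀ s, Matrix (P s) (P s) ℝ, (∀ s, (W s).IsSymm) →
      (∀ s, principal X₀ (P s) * W s = 0) → U₀ = ∑ s, zeroPad (W s) → W = W₀ := by
    intro W hW h0 hsum
    refine sub_eq_zero.1 (hinj (W - W₀) (fun s => (hW s).sub (hW₀symm s)) (fun s => ?_) ?_)
    · rw [Pi.sub_apply, Matrix.mul_sub, h0, hker₀, sub_zero]
    · have hs : ∀ s, zeroPad ((W - W₀) s) = zeroPad (W s) - zeroPad (W₀ s) := by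
        intro s
        rw [eq_sub_iff_add_eq, ← zeroPad_add, Pi.sub_apply, sub_add_cancel]
      simp only [hs, Finset.sum_sub_distrib]
      rw [← hsum, ← hU₀, sub_self]
  obtain ⟨C, hC'⟩ := exists_bound_of_lyapunov (P := P) (X₀ := X₀) U₀ fun W hW =>
    hinj W hW.1 (fun s => mul_eq_zero_of_lyapunov (hA₀ s) (hW.1 s) (hW.2.1 s)) hW.2.2.symm
  obtain ⟨O₁, hO₁, hlyap⟩ := exists_nhds_blocks fun s => (hW₀ s).eventually_of_lyapunov (hA₀ s)
  obtain ⟨O₂, hO₂, hcompl⟩ := exists_nhds_blocks fun s => (hW₀ s).eventually_mul_eq_zero (hA₀ s)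
  have hnear₁ := eventually_mem_of_unique (y₀ := (X₀, U₀))
    (isCompact_setOf_entries_mem_Icc P C) isClosed_lyapunovRelation
    (fun W _ hW => huniq W hW.1
      (fun s => mul_eq_zero_of_lyapunov (hA₀ s) (hW.1 s) (hW.2.1 s)) hW.2.2) hO₁
  set C₂ : ℝ := ∑ i, ∑ j, |U₀ i j| + 1 with hC₂
  have hnear₂ := eventually_mem_of_unique (y₀ := (X₀, U₀))
    (isCompact_setOf_entries_mem_Icc P C₂) isClosed_complementaryRelation
    (fun W _ hW => huniq W (fun s => (posSemidef_iff_real.1 (hW.1 s)).1)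
      (fun s => mul_eq_zero_of_trace_eq_zero (hA₀ s) (hW.1 s) (hW.2.1 s)) hW.2.2) hO₂
  have hbound : ∀ᶠ z in 𝓝 (X₀, U₀), ∀ i j, z.2 i j ≤ C₂ := by
    rw [eventually_all]
    intro i
    rw [eventually_all]
    intro j
    have hc : Continuous fun z : Matrix (Fin p) (Fin p) ℝ × Matrix (Fin p) (Fin p) ℝ =>
        z.2 i j := by
      fun_prop
    have hlt : U₀ i j < C₂ := by
      have h5 : |U₀ i j| ≤ ∑ i, ∑ j, |U₀ i j| :=
        (Finset.single_le_sum (f := fun j => |U₀ i j|) (fun j _ => abs_nonneg _)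
          (Finset.mem_univ j)).trans (Finset.single_le_sum (f := fun i => ∑ j, |U₀ i j|)
          (fun i _ => Finset.sum_nonneg fun j _ => abs_nonneg _) (Finset.mem_univ i))
      have h6 := le_abs_self (U₀ i j)
      linarith
    exact ((hc.tendsto (X₀, U₀)).eventually (gt_mem_nhds hlt)).mono fun z hz => hz.le
  filter_upwards [hC', hnear₁, hnear₂, hbound, continuousAt_fst.eventually hlyap,
    continuousAt_fst.eventually hcompl, continuousAt_fst.eventually (eventually_mem_cop hX₀ hzero),
    continuousAt_fst.eventually (eventually_supp_subset hX₀ hzero)]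
    with ⟨X, U⟩ hbd hn₁ hn₂ hbd₂ hly hco hcop hsup hX
  constructor
  · rintro ⟨hXc, hUc, hXU⟩
    obtain ⟨N, B, hB, hB0, hUB⟩ := exists_zeros_of_mem_cp hXc hUc hXU
    obtain ⟨I, hI, hsum⟩ := exists_sum_zeroPad P B fun i hi => hsup hXc _ (hB i) hi (hB0 i)
    set W : ∀ s, Matrix (P s) (P s) ℝ := fun s =>
      ∑ i ∈ I s, vecMulVec (restrictTo (P s) (B i)) (restrictTo (P s) (B i)) with hW
    have hUW : U = ∑ s, zeroPad (W s) := hUB.trans hsum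
    have hPSD : ∀ s, (W s).PosSemidef := fun s => posSemidef_sum_vecMulVec _ _
    have htr : ∀ s, (principal X (P s) * W s).trace = 0 := by
      intro s
      rw [hW, Matrix.mul_sum, trace_sum]
      refine Finset.sum_eq_zero fun i hi => ?_
      rw [trace_mul_vecMulVec_self, dotProduct_principal_mulVec, zeroExtend_restrictTo (hI s i hi),
        hB0]
    have hWnn : ∀ s k q, 0 ≤ W s k q := by
      intro s k q
      change 0 ≤ (∑ i ∈ I s, vecMulVec (restrictTo (P s) (B i)) (restrictTo (P s) (B i))) k q
      rw [Matrix.sum_apply]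
      exact Finset.sum_nonneg fun i _ => mul_nonneg (hB i k) (hB i q)
    -- All blocks are entrywise nonnegative, so each of them is bounded by their sum `U`.
    have hWle : ∀ s k q, W s k q ≤ U k q := by
      intro s k q
      rw [hUW, Matrix.sum_apply]
      have hpad : zeroPad (W s) k q = W s k q := by simp [zeroPad]
      rw [← hpad]
      refine Finset.single_le_sum (f := fun s => zeroPad (W s) (k : Fin p) (q : Fin p))
        (fun r _ => ?_) (Finset.mem_univ s)
      simp only [zeroPad, of_apply]
      split_ifs
      · exact hWnn r _ _
      · exact le_rfl
    have hWO := hn₂ W (fun s k q => ⟨?_, (hWle s k q).trans (hbd₂ _ _)⟩) ⟨hPSD, htr, hUW⟩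
    · refine ⟨W, fun s => (posSemidef_iff_real.1 (hPSD s)).1, fun s => ?_, hUW⟩
      have h0 := hco W hWO s (isSymm_principal hX) (principal_copositive hXc _) (hPSD s) (htr s)
      have h0' := congrArg transpose h0
      rw [transpose_mul, (posSemidef_iff_real.1 (hPSD s)).1.eq, (isSymm_principal hX).eq,
        transpose_zero] at h0'
      exact (congrArg₂ (· + ·) h0 h0').trans (add_zero 0)
    · have h5 : 0 ≤ ∑ i, ∑ j, |U₀ i j| :=
        Finset.sum_nonneg fun i _ => Finset.sum_nonneg fun j _ => abs_nonneg _
      have h6 := hWnn s k q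
      linarith
  · rintro ⟨W, hWs, hWl, hUW⟩
    have hR : ((X, U), W) ∈ lyapunovRelation P := ⟨hWs, hWl, hUW⟩
    have hblock := fun s => hly W (hn₁ W (hbd W hR) hR) s (isSymm_principal hX) (hWs s) (hWl s)
    refine ⟨hcop hX fun s => (hblock s).1, ?_, ?_⟩
    · rw [hUW]
      refine Submodule.sum_mem _ fun s _ => ?_
      obtain ⟨N, a, ha, hWa⟩ := (hblock s).2
      have hWa' : W s = ∑ l, vecMulVec (a l) (a l) := hWa
      rw [hWa']
      exact zeroPad_sum_vecMulVec_mem_cp _ fun l _ k => (ha l k).le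
    · change ip X U = 0
      have hUW' : U = ∑ s, zeroPad (W s) := hUW
      rw [hUW', ip_sum_right]
      refine Finset.sum_eq_zero fun s _ => ?_
      rw [ip_zeroPad, mul_eq_zero_of_lyapunov (hblock s).1 (hWs s) (hWl s), trace_zero]

end Localization

end CopCP

theorem theorem3 {p n m : ℕ} (X₀ U₀ : Matrix (Fin p) (Fin p) ℝ)
    (hC : (X₀, U₀) ∈ complementaritySet p)
    (τ : Fin n → Fin p → ℝ) (hτ : IsVertexList X₀ τ)
    (J : Fin m → Finset (Fin n)) (hJ : IsZeroPartition X₀ τ J)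
    (Jb : Fin m → Finset (Fin n)) (hJb : ∀ s, IsRankBasis τ (J s) (Jb s))
    (h1 : IsStrictlyComplementary U₀ X₀)
    (h2 : IsNondegenerate τ Jb)
    (h3 : ∀ s, ∀ j ∈ J s, indexM X₀ τ j = indexP τ (J s)) :
    ∃ ε₀ : ℝ, 0 < ε₀ ∧ ∀ X U : Matrix (Fin p) (Fin p) ℝ, X.IsSymm → U.IsSymm →
      pairNorm (X - X₀) (U - U₀) ≤ ε₀ →
      ((X, U) ∈ complementaritySet p ↔
        ∃ W : ∀ s : Fin m, Matrix (indexP τ (J s)) (indexP τ (J s)) ℝ,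
          (∀ s, (W s).IsSymm) ∧
          (∀ s, principal X (indexP τ (J s)) * W s + W s * principal X (indexP τ (J s)) = 0) ∧
          U = ∑ s, zeroPad (W s)) := by
  have hX₀ : X₀ ∈ cop p := hC.1
  have hJc := hJ.1
  obtain ⟨W₀, hW₀, hU₀⟩ := h1.exists_blocks hX₀ hτ hJc h3
  have hmain := eventually_mem_complementaritySet_iff hX₀
    (fun t ht hne h0 => (exists_block_of_zero hX₀ hτ hJc h3 ht hne h0).imp fun s hs => hs.1)
    (posSemidef_principal hX₀ hτ hJc)
    (fun W hW h0 hsum => funext (h2.eq_zero_of_sum_eq_zero (fun s x hx => by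
      rw [(hJb s).span_eq]
      exact zeroExtend_mem_span hX₀ hτ hJc h3 s hx) hW h0 hsum))
    hW₀ hU₀
  obtain ⟨ε, hε, h⟩ := exists_pairNorm_ball hX₀.1 (isSymm_of_mem_cp hC.2.1) hmain
  exact ⟨ε, hε, fun X U hX hU hle => h X U hX hU hle hX⟩
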